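/- Let $r\ge 2$ be an integer and $\alpha=\frac{r+1}{2r}$. For a graph $G$ on $n$ vertices and a colouring of $E(G)$ with $r$ colours (an $r$-colouring: any map from $E(G)$ to an $r$-element set), the colour bias of a Hamilton cycle $H$ of $G$ is the largest real $t$ such that some colour occurs on exactly $n/r+t$ edges of $H$. Let $h_r(G)$ be the minimum, over all $r$-colourings of $E(G)$, of the maximum colour bias of a Hamilton cycle of $G$ (with maximum $-\infty$ if $G$ has no Hamilton cycle). Let $\Gamma_\alpha(n)$ be the set of graphs on the vertex set $\{1,\dots,n\}$ with minimum degree at least $\alpha n$. Let $G(n,m)$ be a uniformly random graph on $\{1,\dots,n\}$ with exactly $m$ edges. "With high probability" means with probability tending to $1$ as $n\to\infty$. 1. There is a constant $c>0$, depending only on $r$, such that the following holds. Let $m=m(n)$ be a sequence of natural numbers with $m(n)\to\infty$ and $m(n)\le n$ for all large $n$, and let $(G_n)$ be a sequence of graphs on $\{1,\dots,n\}$ with $G_n\in\Gamma_\alpha(n)$ for all large $n$. Then with high probability $$h_r\big(G_n\cup G(n,m)\big)\ge c\,m.$$ 2. If moreover $m(n)<2^{-5}r^{-1}n$ for all large $n$,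 then with high probability every $r$-colouring of $E(G_n\cup G(n,m))$ has a Hamilton cycle with colour bias at least $2^{-20}r^{-1}m$. 3. Conversely, for every $n\ge 1$ divisible by $2r$ and every integer $m\ge 0$ there is a graph $G\in\Gamma_\alpha(n)$ such that $$h_r(G\cup F)\le 2(r-1)\,m$$ for every graph $F$ on $\{1,\dots,n\}$ with exactly $m$ edges. Moreover there is a constant $C>0$, depending only on $r$, such that for every $n\ge 4$ and every $m\ge 1$ there is a graph $G\in\Gamma_\alpha(n)$ such that $h_r(G\cup F)\le C\,m$ for every graph $F$ on $\{1,\dots,n\}$ with exactly $m$ edges. -/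

import Mathlib

open Filter Topology

noncomputable section

namespace ColourBias

/-- An `r`-colouring of the edges of `G`: an arbitrary map from the edge set to `r` colours. -/
abbrev Colouring {V : Type*} (r : ℕ) (G : SimpleGraph V) : Type _ := G.EdgeLabeling (Fin r)

/-- The number of edges of colour `i` on the closed walk `p` (each edge is counted once). -/
def colourCount {V : Type*} {r : ℕ} {G : SimpleGraph V} (χ : Colouring r G) {v : V}
    (p : G.Walk v v) (i : Fin r) : ℕ :=
  Set.ncard {e : G.edgeSet | (e : Sym2 V) ∈ p.edges ∧ χ e = i}

/-- The colour bias of a closed walk `p` (used for Hamilton cycles): the largest `t` such that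
some colour occurs `|V| / r + t` times on `p`. -/
def bias {V : Type*} [Fintype V] {r : ℕ} {G : SimpleGraph V} (χ : Colouring r G) {v : V}
    (p : G.Walk v v) : ℝ :=
  ⨆ i : Fin r, ((colourCount χ p i : ℝ) - (Fintype.card V : ℝ) / r)

/-- `h_r(G)`: the minimum over all `r`-colourings of `G` of the maximum colour bias of a
Hamilton cycle of `G`. The value is an extended real, so that the maximum over an empty set of
Hamilton cycles is `⊥` (that is, `-∞`) rather than a real number. -/
def hr {V : Type*} [Fintype V] [DecidableEq V] (r : ℕ) (G : SimpleGraph V) : EReal :=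
  ⨅ χ : Colouring r G, ⨆ (v : V) (p : G.Walk v v) (_ : p.IsHamiltonianCycle),
    ((bias χ p : ℝ) : EReal)

open scoped Classical in
/-- `Γ_α(n)`: the graphs on `n` vertices with minimum degree at least `α n`. -/
def Gam (α : ℝ) (n : ℕ) : Set (SimpleGraph (Fin n)) :=
  {G | α * n ≤ (G.minDegree : ℝ)}

/-- The graphs on `n` labelled vertices with exactly `m` edges. -/
def withEdges (n m : ℕ) : Set (SimpleGraph (Fin n)) :=
  {F | F.edgeSet.ncard = m}

/-- The probability that the random graph `G(n, m)`, which is uniformly distributed on the graphs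
with `n` labelled vertices and exactly `m` edges, lies in `S`. (It is only used with
`m ≤ n.choose 2`, where there is at least one such graph.) -/
def gnmProb (n m : ℕ) (S : Set (SimpleGraph (Fin n))) : ℝ :=
  ((withEdges n m ∩ S).ncard : ℝ) / ((withEdges n m).ncard : ℝ)

/-- With high probability `G n ∪ G(n, m n)` has the property `P`: the probability tends to `1`
as `n → ∞`. -/
def UnionWhp (G : ∀ n, SimpleGraph (Fin n)) (m : ℕ → ℕ)
    (P : ∀ n, SimpleGraph (Fin n) → Prop) : Prop :=
  Tendsto (fun n => gnmProb n (m n) {F | P n (G n ⊔ F)}) atTop (𝓝 1)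

end ColourBias

end

/-!
# Colour bias of Hamilton cycles in randomly perturbed graphs

**Lower bound.** Let `U = G ∪ F`, where `G` has minimum degree at least `(r + 1) n / (2 r)`, and fix
an `r`-colouring of `U`. A *bowtie* consists of two triangles `v x y` and `v z w`. A Hamilton cycle
through the paths `x v y` and `z w` stays a Hamilton cycle if these are replaced by `x y` and
`z v w`; the bowtie is a *gadget* if this changes the number of edges of some colour. There are two
cases.

* There are `k` disjoint gadgets. By Pósa's theorem (`exists_isHam_of_degree`) a Hamilton cycle runs
  through all of them. For each colour, reroute it through those gadgets which gain that colour.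
  On average over the colours this gains at least one edge per gadget, so one of the cycles has
  bias at least `k / r` (`exists_isHam_of_gadgets`).
* A set `D` of at most `5 k` vertices meets all gadgets. Outside `D`, the quantity
  `[v x has colour i] + [v y has colour i] - [x y has colour i]` is the same for all triangles
  `v x y` at `v`. It is therefore twice a vertex potential `f i` such that `f i u + f i v` is the
  indicator of the edge `u v` having colour `i`. As the `f i v` sum to `1 / 2`, for some
  colour `s` all values of `f s` are half-integers, hence `± 1 / 2`. The vertices of value `- 1 / 2`
  form an independent set `A`, and edges that avoid `A` have colour `s`
  (`exists_indep_of_no_gadget`). Either colour `s` alone gives every Hamilton cycle bias at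
  least `k / r`, or `A` has almost `(r - 1) n / (2 r)` vertices (`exists_biased_or_indep`).

In the last case `A` is independent in `G` and in `F`. By the degree condition, large independent
sets of `G` are approximated, up to `6 k` vertices, by at most five of them
(`exists_representative_indep`). So, for one of five fixed sets `I`, all edges of `F`
inside `I` are covered by `6 k` vertices. For a random `F` with `m` edges and `k` much smaller than
`m`, this has probability exponentially small in `m` (`card_coverable_le`).

**Upper bound.** In the complete graph without the edges inside a set of `(r - 1) n / (2 r)`
vertices, divide this set evenly into `r - 1` classes, give the edges at the `i`-th class colour `i`
and all other edges the last colour. Each colour is then used equally often on a Hamilton cycle, and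
`m` further edges change this by at most `2 m` (`hr_splitGraph_le`).
-/

/-! ### Hamilton cycles as cyclic lists, and Pósa's theorem -/

namespace ColourBias

/-- The edges joining consecutive entries of a list, with multiplicity. -/
def pathEdges {V : Type*} : List V → Multiset (Sym2 V)
  | [] => 0
  | [_] => 0
  | a :: b :: l => s(a, b) ::ₘ pathEdges (b :: l)

/-- The edges joining cyclically consecutive entries of a list: a list without repetitions is
read as a cyclic order, whose closing edge joins the last entry to the first one. -/
def cycleEdges {V : Type*} : List V → Multiset (Sym2 V)
  | [] => 0
  | a :: l => pathEdges (a :: l) + {s((a :: l).getLast (by simp), a)}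

section Lists

variable {V : Type*}

lemma pathEdges_append : ∀ {A B : List V} (hA : A ≠ []) (hB : B ≠ []),
    pathEdges (A ++ B) = pathEdges A + pathEdges B + {s(A.getLast hA, B.head hB)}
  | [], _, hA, _ => absurd rfl hA
  | [a], [], _, hB => absurd rfl hB
  | [a], b :: B, _, _ => by
      simp [pathEdges, add_comm, ← Multiset.singleton_add]
  | a :: a' :: A, B, _, hB => by
      have h := pathEdges_append (A := a' :: A) (by simp) hB
      simp only [List.cons_append] at h ⊢
      simp only [pathEdges, h, List.getLast_cons_cons, Multiset.cons_add]

lemma cycleEdges_eq {l : List V} (h : l ≠ []) :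
    cycleEdges l = pathEdges l + {s(l.getLast h, l.head h)} := by
  cases l with
  | nil => exact absurd rfl h
  | cons a l => rfl

lemma cycleEdges_append {A B : List V} (hA : A ≠ []) (hB : B ≠ []) :
    cycleEdges (A ++ B) = pathEdges A + pathEdges B +
      {s(A.getLast hA, B.head hB)} + {s(B.getLast hB, A.head hA)} := by
  rw [cycleEdges_eq (by simp [hA]), pathEdges_append hA hB]
  simp [List.getLast_append_of_ne_nil, List.head_append_of_ne_nil, hA, hB]

lemma cycleEdges_append_comm (A B : List V) : cycleEdges (A ++ B) = cycleEdges (B ++ A) := by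
  by_cases hA : A = []
  · simp [hA]
  by_cases hB : B = []
  · simp [hB]
  rw [cycleEdges_append hA hB, cycleEdges_append hB hA]
  abel

lemma pathEdges_reverse : ∀ l : List V, pathEdges l.reverse = pathEdges l
  | [] => rfl
  | [a] => rfl
  | a :: b :: l => by
      rw [List.reverse_cons, pathEdges_append (by simp) (by simp), pathEdges_reverse (b :: l)]
      simp [pathEdges, Sym2.eq_swap, add_comm, ← Multiset.singleton_add]

lemma card_pathEdges_cons : ∀ (a : V) (l : List V), (pathEdges (a :: l)).card = l.length
  | _, [] => rfl
  | _, b :: l => by simp [pathEdges, card_pathEdges_cons b l]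

lemma card_cycleEdges : ∀ l : List V, (cycleEdges l).card = l.length
  | [] => rfl
  | a :: l => by simp [cycleEdges, card_pathEdges_cons]

lemma mem_of_mem_pathEdges : ∀ {l : List V} {e : Sym2 V} {v : V},
    e ∈ pathEdges l → v ∈ e → v ∈ l
  | [], _, _, he, _ => by simp [pathEdges] at he
  | [_], _, _, he, _ => by simp [pathEdges] at he
  | a :: b :: l, e, v, he, hv => by
      simp only [pathEdges, Multiset.mem_cons] at he
      rcases he with rfl | he
      · rcases Sym2.mem_iff.1 hv with rfl | rfl <;> simp
      · exact List.mem_cons_of_mem _ (mem_of_mem_pathEdges he hv)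

lemma exists_split_of_mem_pathEdges : ∀ {l : List V} {e : Sym2 V}, e ∈ pathEdges l →
    ∃ (A B : List V) (hA : A ≠ []) (hB : B ≠ []), l = A ++ B ∧ e = s(A.getLast hA, B.head hB)
  | [], _, he => by simp [pathEdges] at he
  | [_], _, he => by simp [pathEdges] at he
  | a :: b :: l, e, he => by
      simp only [pathEdges, Multiset.mem_cons] at he
      rcases he with rfl | he
      · exact ⟨[a], b :: l, by simp, by simp, rfl, rfl⟩
      · obtain ⟨A, B, hA, hB, h, h'⟩ := exists_split_of_mem_pathEdges he
        exact ⟨a :: A, B, by simp, hB, by simp [h], by rw [h', List.getLast_cons hA]⟩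

/-- Every edge of a cyclic order is the closing edge of one of its rotations. -/
lemma exists_rotation_closing {l : List V} {e : Sym2 V} (he : e ∈ cycleEdges l) :
    ∃ (l' : List V) (h : l' ≠ []), l'.Perm l ∧ cycleEdges l' = cycleEdges l ∧
      e = s(l'.getLast h, l'.head h) := by
  have hl : l ≠ [] := by rintro rfl; simp [cycleEdges] at he
  rw [cycleEdges_eq hl] at he
  rcases Multiset.mem_add.1 he with he | he
  · obtain ⟨A, B, hA, hB, rfl, rfl⟩ := exists_split_of_mem_pathEdges he
    refine ⟨B ++ A, by simp [hA], List.perm_append_comm, cycleEdges_append_comm _ _, ?_⟩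
    simp [List.getLast_append_of_ne_nil, List.head_append_of_ne_nil, hA, hB]
  · exact ⟨l, hl, List.Perm.refl _, rfl, Multiset.mem_singleton.1 he⟩

lemma exists_rotation_head {l : List V} {v : V} (hv : v ∈ l) :
    ∃ t : List V, (v :: t).Perm l ∧ cycleEdges (v :: t) = cycleEdges l := by
  obtain ⟨A, B, rfl⟩ := List.append_of_mem hv
  exact ⟨B ++ A, by simpa using List.perm_append_comm (l₁ := v :: B) (l₂ := A),
    by simpa using cycleEdges_append_comm (v :: B) A⟩

/-- A list that runs through all vertices, without repetition. -/
def IsOrder (l : List V) : Prop := l.Nodup ∧ ∀ v, v ∈ l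

lemma IsOrder.perm {l l' : List V} (h : IsOrder l) (hl : l'.Perm l) : IsOrder l' :=
  ⟨hl.nodup_iff.2 h.1, fun v => hl.mem_iff.2 (h.2 v)⟩

end Lists

section Hamilton

variable {V : Type*}

/-- A cyclic order of all vertices in which consecutive vertices are adjacent, that is, a
Hamilton cycle of `G` (if there are at least three vertices). -/
def IsHam (G : SimpleGraph V) (l : List V) : Prop :=
  IsOrder l ∧ ∀ e ∈ cycleEdges l, e ∈ G.edgeSet

lemma IsOrder.length_eq [Fintype V] {l : List V} (h : IsOrder l) : l.length = Fintype.card V := by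
  classical
  rw [← List.toFinset_card_of_nodup h.1, ← Finset.card_univ]
  congr 1
  ext v
  simp [h.2 v]

lemma exists_walk_of_pathEdges {G : SimpleGraph V} (b : V) : ∀ (l : List V) (a : V),
    (∀ e ∈ pathEdges (a :: l ++ [b]), e ∈ G.edgeSet) →
    ∃ p : G.Walk a b, p.support = a :: l ++ [b] ∧
      (p.edges : Multiset (Sym2 V)) = pathEdges (a :: l ++ [b])
  | [], a, h => by
      have hab : G.Adj a b := h s(a, b) (by simp [pathEdges])
      exact ⟨hab.toWalk, by simp, by simp [pathEdges]⟩
  | c :: l, a, h => by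
      have hac : G.Adj a c := h s(a, c) (by simp [pathEdges])
      obtain ⟨p, hp, hp'⟩ := exists_walk_of_pathEdges b l c
        (fun e he => h e (by simpa [pathEdges] using Or.inr he))
      exact ⟨p.cons hac, by simp [hp], by simpa [pathEdges, ← Multiset.cons_coe] using hp'⟩

/-- A Hamiltonian cyclic order is the vertex sequence of a Hamilton cycle in Mathlib's sense. -/
lemma IsHam.exists_walk [Fintype V] [DecidableEq V] {G : SimpleGraph V} {l : List V} (h : IsHam G l)
    (hV : 3 ≤ Fintype.card V) :
    ∃ (v : V) (p : G.Walk v v), p.IsHamiltonianCycle ∧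
      (p.edges : Multiset (Sym2 V)) = cycleEdges l := by
  have hlen := h.1.length_eq
  obtain ⟨⟨hnd, hmem⟩, hE⟩ := h
  match l, hlen with
  | [], hlen => simp at hlen; omega
  | [_], hlen => simp at hlen; omega
  | [_, _], hlen => simp at hlen; omega
  | a :: b :: c :: t, _ =>
    have hcyc : cycleEdges (a :: b :: c :: t) = s(a, b) ::ₘ pathEdges (b :: (c :: t) ++ [a]) := by
      rw [pathEdges_append (by simp) (by simp), cycleEdges_eq (by simp)]
      simp [pathEdges]
    rw [hcyc] at hE ⊢
    have hab : G.Adj a b := hE s(a, b) (by simp)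
    obtain ⟨q, hq, hq'⟩ := exists_walk_of_pathEdges (G := G) a (c :: t) b
      (fun e he => hE e (Multiset.mem_cons_of_mem he))
    refine ⟨a, q.cons hab, ?_, by simpa [← Multiset.cons_coe] using hq'⟩
    have hqnd : q.support.Nodup := by
      rw [hq]
      have : (b :: c :: t ++ [a]).Perm (a :: b :: c :: t) := by
        simpa using List.perm_append_comm (l₁ := b :: c :: t) (l₂ := [a])
      exact this.nodup_iff.2 hnd
    rw [SimpleGraph.Walk.isHamiltonianCycle_iff_isCycle_and_support_count_tail_eq_one]
    constructor
    · rw [SimpleGraph.Walk.cons_isCycle_iff]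
      refine ⟨SimpleGraph.Walk.IsPath.mk' hqnd, fun he => ?_⟩
      rw [← Multiset.mem_coe, hq'] at he
      simp only [List.cons_append, pathEdges, Multiset.mem_cons] at he
      simp only [List.nodup_cons, List.mem_cons, not_or] at hnd
      rcases he with he | he
      · rw [Sym2.eq_iff] at he
        rcases he with he | he
        · exact hnd.1.1 he.1
        · exact hnd.1.2.1 he.1
      · have := mem_of_mem_pathEdges (v := b) he (by simp)
        simp only [List.mem_cons, List.mem_append, List.not_mem_nil, or_false] at this
        rcases this with h1 | h1 | h1
        · exact hnd.2.1.1 h1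
        · exact hnd.2.1.2 h1
        · exact hnd.1.1 h1.symm
    · intro v
      simp only [SimpleGraph.Walk.support_cons, List.tail_cons]
      refine List.count_eq_one_of_mem hqnd ?_
      rw [hq]
      have := hmem v
      simp only [List.mem_cons, List.mem_append, List.cons_append] at this ⊢
      tauto

/-- One step of Pósa's argument: if the closing edge of a cyclic order is not an edge of `G`, a
reversal of a final segment removes it, together with one edge outside `L`, and introduces two
edges of `G`. -/
lemma exists_reversal [Fintype V] [DecidableEq V] {G : SimpleGraph V} [DecidableRel G.Adj]
    (L : Finset (Sym2 V)) (hdeg : ∀ v, Fintype.card V + L.card ≤ 2 * G.degree v)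
    {l : List V} (hl : IsOrder l) (hne : l ≠ []) :
    ∃ (l' : List V) (e f g : Sym2 V), l'.Perm l ∧ e ∉ L ∧ f ∈ G.edgeSet ∧ g ∈ G.edgeSet ∧
      cycleEdges l' + {e, s(l.getLast hne, l.head hne)} = cycleEdges l + {f, g} := by
  set n := Fintype.card V with hn
  have hlen : l.length = n := hl.length_eq
  set a := l.head hne with ha
  set z := l.getLast hne with hz
  have hn0 : 0 < n := by rw [← hlen]; exact List.length_pos_iff.2 hne
  set f : ℕ → V := fun i => l.getD i a with hf
  have hfi : ∀ i (hi : i < l.length), f i = l[i] := fun i hi => by simp [hf, hi]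
  have hf0 : f 0 = a := by
    rw [hfi 0 (by omega), ha, List.head_eq_getElem]
  have hfl : f (n - 1) = z := by
    rw [hfi _ (by omega), hz, List.getLast_eq_getElem]; simp [hlen]
  have hinj : ∀ i j, i < n → j < n → f i = f j → i = j := by
    intro i j hi hj h
    rw [hfi i (by omega), hfi j (by omega)] at h
    exact (List.Nodup.getElem_inj_iff hl.1).1 h
  have hsurj : ∀ v, ∃ i < n, f i = v := by
    intro v
    obtain ⟨i, hi, h⟩ := List.getElem_of_mem (hl.2 v)
    exact ⟨i, by omega, by rw [hfi i hi, h]⟩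
  set S1 := (Finset.range (n - 1)).filter (fun i => G.Adj a (f (i + 1))) with hS1
  set S2 := (Finset.range (n - 1)).filter (fun i => G.Adj (f i) z) with hS2
  set S3 := (Finset.range (n - 1)).filter (fun i => s(f i, f (i + 1)) ∈ L) with hS3
  have h1 : G.degree a ≤ S1.card := by
    rw [← SimpleGraph.card_neighborFinset_eq_degree]
    refine (Finset.card_le_card (t := S1.image (fun i => f (i + 1))) ?_).trans
      Finset.card_image_le
    intro w hw
    rw [SimpleGraph.mem_neighborFinset] at hw
    obtain ⟨j, hj, rfl⟩ := hsurj w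
    have hj0 : j ≠ 0 := by
      rintro rfl
      rw [hf0] at hw
      exact hw.ne rfl
    rw [Finset.mem_image]
    refine ⟨j - 1, ?_, by rw [Nat.sub_add_cancel (by omega)]⟩
    rw [hS1, Finset.mem_filter, Finset.mem_range, Nat.sub_add_cancel (by omega)]
    exact ⟨by omega, hw⟩
  have h2 : G.degree z ≤ S2.card := by
    rw [← SimpleGraph.card_neighborFinset_eq_degree]
    refine (Finset.card_le_card (t := S2.image f) ?_).trans Finset.card_image_le
    intro w hw
    rw [SimpleGraph.mem_neighborFinset] at hw
    obtain ⟨j, hj, rfl⟩ := hsurj w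
    have hj0 : j ≠ n - 1 := by
      rintro rfl
      rw [hfl] at hw
      exact hw.ne rfl
    rw [Finset.mem_image]
    refine ⟨j, ?_, rfl⟩
    rw [hS2, Finset.mem_filter, Finset.mem_range]
    exact ⟨by omega, hw.symm⟩
  have h3 : S3.card ≤ L.card := by
    refine Finset.card_le_card_of_injOn (fun i => s(f i, f (i + 1))) ?_ ?_
    · intro i hi
      exact (Finset.mem_filter.1 (Finset.mem_coe.1 hi)).2
    · intro i hi j hj hij
      have hi' := Finset.mem_range.1 (Finset.mem_filter.1 (Finset.mem_coe.1 hi)).1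
      have hj' := Finset.mem_range.1 (Finset.mem_filter.1 (Finset.mem_coe.1 hj)).1
      simp only [Sym2.eq_iff] at hij
      rcases hij with h | h
      · exact hinj i j (by omega) (by omega) h.1
      · have e1 := hinj i (j + 1) (by omega) (by omega) h.1
        have e2 := hinj (i + 1) j (by omega) (by omega) h.2
        omega
  have h12 : (S1 ∪ S2).card ≤ n - 1 := by
    refine (Finset.card_le_card ?_).trans (Finset.card_range (n - 1)).le
    exact Finset.union_subset (Finset.filter_subset _ _) (Finset.filter_subset _ _)
  have h12' := Finset.card_union_add_card_inter S1 S2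
  have hlt : S3.card < (S1 ∩ S2).card := by
    have := hdeg a
    have := hdeg z
    omega
  obtain ⟨i, hi, hi3⟩ := Finset.exists_mem_notMem_of_card_lt_card hlt
  obtain ⟨hi1, hi2⟩ := Finset.mem_inter.1 hi
  rw [hS1, Finset.mem_filter, Finset.mem_range] at hi1
  rw [hS2, Finset.mem_filter, Finset.mem_range] at hi2
  have hi3' : s(f i, f (i + 1)) ∉ L := fun h =>
    hi3 (Finset.mem_filter.2 ⟨Finset.mem_range.2 hi1.1, h⟩)
  have hA : l.take (i + 1) ≠ [] := by simp [hne]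
  have hB : l.drop (i + 1) ≠ [] := by
    rw [Ne, List.drop_eq_nil_iff]; omega
  have hAB : l.take (i + 1) ++ l.drop (i + 1) = l := List.take_append_drop _ _
  have eA : (l.take (i + 1)).getLast hA = f i := by
    rw [List.getLast_eq_getElem, hfi i (by omega)]
    simp [List.length_take, Nat.min_eq_left (show i + 1 ≤ l.length by omega)]
  have eB : (l.drop (i + 1)).head hB = f (i + 1) := by
    rw [List.head_eq_getElem, hfi (i + 1) (by omega)]
    simp
  have eA' : (l.take (i + 1)).head hA = a := by
    rw [ha, List.head_eq_getElem, List.head_eq_getElem]; simp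
  have eB' : (l.drop (i + 1)).getLast hB = z := by simp [hz]
  refine ⟨l.take (i + 1) ++ (l.drop (i + 1)).reverse, s(f i, f (i + 1)), s(f i, z),
    s(f (i + 1), a), ?_, hi3', hi2.2, hi1.2.symm, ?_⟩
  · conv_rhs => rw [← hAB]
    exact (List.reverse_perm _).append_left _
  · conv_rhs => rw [← hAB, cycleEdges_append hA hB]
    rw [cycleEdges_append hA (by simpa using hB), pathEdges_reverse, List.head_reverse,
      List.getLast_reverse, eA, eB, eA', eB']
    simp only [Multiset.insert_eq_cons, ← Multiset.singleton_add]
    abel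

/-- Pósa's theorem on Hamilton cycles through a linear forest: a set `L` of edges of `G` that
occurs in some cyclic order of the vertices lies on a Hamilton cycle, if all degrees are at
least `(n + |L|) / 2`. -/
theorem exists_isHam_of_degree [Fintype V] [DecidableEq V] {G : SimpleGraph V} [DecidableRel G.Adj]
    (L : Finset (Sym2 V)) (hLG : ∀ e ∈ L, e ∈ G.edgeSet)
    (hdeg : ∀ v, Fintype.card V + L.card ≤ 2 * G.degree v) {l : List V} (hl : IsOrder l)
    (hL : ∀ e ∈ L, e ∈ cycleEdges l) :
    ∃ l', IsHam G l' ∧ ∀ e ∈ L, e ∈ cycleEdges l' := by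
  classical
  induction hN : (cycleEdges l).countP (· ∉ G.edgeSet) using Nat.strong_induction_on
    generalizing l with
  | _ N ih =>
    by_cases hbad : ∀ e ∈ cycleEdges l, e ∈ G.edgeSet
    · exact ⟨l, ⟨hl, hbad⟩, hL⟩
    push Not at hbad
    obtain ⟨e₀, he₀, he₀G⟩ := hbad
    obtain ⟨l₁, hne, hperm, hcyc, hclose⟩ := exists_rotation_closing he₀
    obtain ⟨l', e, f, g, hp', heL, hf, hg, heq⟩ :=
      exists_reversal (G := G) L hdeg (hl.perm hperm) hne
    rw [← hclose, hcyc] at heq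
    refine ih _ ?_ (hl.perm (hp'.trans hperm)) (fun x hx => ?_) rfl
    · have := congrArg (Multiset.countP (· ∉ G.edgeSet)) heq
      simp only [Multiset.countP_add, Multiset.insert_eq_cons,
        ← Multiset.cons_zero e₀, ← Multiset.cons_zero g, Multiset.countP_cons,
        Multiset.countP_zero] at this
      simp only [hf, hg, he₀G, not_true_eq_false, not_false_eq_true, if_true, if_false] at this
      rw [← hN]
      omega
    · have : x ∈ cycleEdges l' + {e, e₀} := heq ▸ Multiset.mem_add.2 (Or.inl (hL x hx))
      simp only [Multiset.mem_add, Multiset.insert_eq_cons, Multiset.mem_cons,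
        Multiset.mem_singleton] at this
      rcases this with h | rfl | rfl
      · exact h
      · exact absurd hx heL
      · exact absurd (hLG _ hx) he₀G

/-- Moving a vertex `v` of a Hamilton cycle from between `x` and `y` to between `z` and `w`. -/
lemma IsHam.move [DecidableEq V] {U : SimpleGraph V} {l : List V} (h : IsHam U l) {v x y z w : V}
    (hxy : x ≠ y) (hzv : z ≠ v) (hwv : w ≠ v) (hx : s(x, v) ∈ cycleEdges l)
    (hy : s(v, y) ∈ cycleEdges l) (hzw : s(z, w) ∈ cycleEdges l)
    (axy : U.Adj x y) (azv : U.Adj z v) (avw : U.Adj v w) :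
    ∃ l', IsHam U l' ∧ cycleEdges l' + {s(x, v), s(v, y), s(z, w)} =
      cycleEdges l + {s(x, y), s(z, v), s(v, w)} := by
  obtain ⟨t, hperm, hcyc⟩ := exists_rotation_head (h.1.2 v)
  have ho := h.1.perm hperm
  have hE := h.2
  rw [← hcyc] at hx hy hzw hE ⊢
  have ht : t ≠ [] := by
    rintro rfl
    simp only [cycleEdges, pathEdges, List.getLast_singleton, zero_add,
      Multiset.mem_singleton, Sym2.eq_iff] at hzw
    tauto
  have hvt : v ∉ t := (List.nodup_cons.1 ho.1).1
  have hct : cycleEdges (v :: t) = pathEdges t + {s(v, t.head ht), s(v, t.getLast ht)} := by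
    have := cycleEdges_append (A := [v]) (B := t) (by simp) ht
    simp only [List.singleton_append, pathEdges, zero_add, List.getLast_singleton,
      List.head_singleton] at this
    rw [this, Sym2.eq_swap (a := t.getLast ht), add_assoc]
    rfl
  have key : ∀ u, s(v, u) ∈ cycleEdges (v :: t) → u = t.head ht ∨ u = t.getLast ht := by
    intro u hu
    rw [hct] at hu
    simp only [Multiset.mem_add, Multiset.insert_eq_cons, Multiset.mem_cons,
      Multiset.mem_singleton] at hu
    rcases hu with hu | hu | hu
    · exact absurd (mem_of_mem_pathEdges hu (by simp)) hvt
    · exact Or.inl (Sym2.congr_right.1 hu)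
    · exact Or.inr (Sym2.congr_right.1 hu)
  have hx' := key x (by rwa [Sym2.eq_swap])
  have hy' := key y hy
  have hends : ({s(v, t.head ht), s(v, t.getLast ht)} : Multiset (Sym2 V)) = {s(x, v), s(v, y)} ∧
      s(t.getLast ht, t.head ht) = s(x, y) := by
    rcases hx' with hx' | hx' <;> rcases hy' with hy' | hy'
    · exact absurd (hx'.trans hy'.symm) hxy
    · rw [← hx', ← hy', Sym2.eq_swap (a := v) (b := x)]
      exact ⟨rfl, Sym2.eq_swap⟩
    · rw [← hx', ← hy', Sym2.eq_swap (a := v) (b := x), Multiset.pair_comm]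
      exact ⟨rfl, rfl⟩
    · exact absurd (hx'.trans hy'.symm) hxy
  have hzt : s(z, w) ∈ pathEdges t := by
    rw [hct] at hzw
    simp only [Multiset.mem_add, Multiset.insert_eq_cons, Multiset.mem_cons,
      Multiset.mem_singleton, Sym2.eq_iff] at hzw
    tauto
  obtain ⟨A, B, hA, hB, rfl, hAB⟩ := exists_split_of_mem_pathEdges hzt
  have hnew : cycleEdges (A ++ v :: B) = pathEdges A + pathEdges B + {s(x, y)} +
      {s(z, v), s(v, w)} := by
    have h1 : cycleEdges (A ++ v :: B) = pathEdges A + pathEdges B + {s(B.getLast hB, A.head hA)} +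
        {s(v, A.getLast hA), s(v, B.head hB)} := by
      have h2 := pathEdges_append (A := [v]) (B := B) (by simp) hB
      simp only [List.singleton_append, pathEdges, zero_add, List.getLast_singleton] at h2
      rw [cycleEdges_append hA (by simp), h2, List.head_cons, List.getLast_cons hB,
        Sym2.eq_swap (a := A.getLast hA)]
      simp only [Multiset.insert_eq_cons, ← Multiset.singleton_add]
      abel
    have h3 : s(B.getLast hB, A.head hA) = s(x, y) := by
      rw [← hends.2]
      simp [List.getLast_append_of_ne_nil, List.head_append_of_ne_nil, hA, hB]
    rw [h1, h3]
    congr 1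
    rw [Sym2.eq_iff] at hAB
    rcases hAB with ⟨rfl, rfl⟩ | ⟨rfl, rfl⟩
    · rw [Sym2.eq_swap (a := v) (b := A.getLast hA)]
    · rw [Sym2.eq_swap (a := v) (b := B.head hB), Multiset.pair_comm]
  have hperm' : (A ++ v :: B).Perm (v :: (A ++ B)) := List.perm_middle
  refine ⟨A ++ v :: B, ⟨ho.perm hperm', fun e he => ?_⟩, ?_⟩
  · rw [hnew] at he
    simp only [Multiset.mem_add, Multiset.insert_eq_cons, Multiset.mem_cons,
      Multiset.mem_singleton] at he
    rcases he with ((he | he) | rfl) | rfl | rfl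
    · refine hE e ?_
      rw [hct, pathEdges_append hA hB]
      simp [he]
    · refine hE e ?_
      rw [hct, pathEdges_append hA hB]
      simp [he]
    · exact axy
    · exact azv
    · exact avw
  · rw [hct, hnew, pathEdges_append hA hB, ← hAB, hends.1]
    simp only [Multiset.insert_eq_cons, ← Multiset.singleton_add]
    abel

end Hamilton

end ColourBias

/-! ### Bowties and gadgets -/

namespace ColourBias

/-- A bowtie: the two triangles `v x y` and `v z w` sharing the vertex `v`. A Hamilton cycle
through the paths `x v y` and `z w` can be rerouted through `x y` and `z v w`. -/
structure Bowtie (V : Type*) where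
  /-- The common vertex of the two triangles. -/
  v : V
  /-- A vertex of the first triangle. -/
  x : V
  /-- A vertex of the first triangle. -/
  y : V
  /-- A vertex of the second triangle. -/
  z : V
  /-- A vertex of the second triangle. -/
  w : V

namespace Bowtie

variable {V : Type*} {r : ℕ}

/-- The five vertices of a bowtie, in an order in which `x v y` and `z w` are consecutive. -/
def verts (b : Bowtie V) : List V := [b.x, b.v, b.y, b.z, b.w]

/-- The edges of the paths `x v y` and `z w`. -/
def oldEdges (b : Bowtie V) : Multiset (Sym2 V) := {s(b.x, b.v), s(b.v, b.y), s(b.z, b.w)}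

/-- The edges of the paths `x y` and `z v w`. -/
def newEdges (b : Bowtie V) : Multiset (Sym2 V) := {s(b.x, b.y), s(b.z, b.v), s(b.v, b.w)}

/-- The gain of colour `i` when a cycle is rerouted through the bowtie. -/
def gain (c : Sym2 V → Fin r) (i : Fin r) (b : Bowtie V) : ℤ :=
  (b.newEdges.countP (c · = i) : ℤ) - b.oldEdges.countP (c · = i)

/-- All six edges of the bowtie belong to `U`, and rerouting changes the number of edges of some
colour. -/
structure IsGadget (U : SimpleGraph V) (c : Sym2 V → Fin r) (b : Bowtie V) : Prop where
  adj_xv : U.Adj b.x b.v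
  adj_vy : U.Adj b.v b.y
  adj_xy : U.Adj b.x b.y
  adj_zv : U.Adj b.z b.v
  adj_vw : U.Adj b.v b.w
  adj_zw : U.Adj b.z b.w
  gain_ne : ∃ i, b.gain c i ≠ 0

end Bowtie

open Bowtie

variable {V : Type*} {r : ℕ}

lemma sum_countP_colour (c : Sym2 V → Fin r) (s : Multiset (Sym2 V)) :
    ∑ i, s.countP (c · = i) = s.card := by
  induction s using Multiset.induction with
  | empty => simp
  | cons a s ih => simp [Multiset.countP_cons, Finset.sum_add_distrib, ih]

lemma sum_gain (c : Sym2 V → Fin r) (b : Bowtie V) : ∑ i, b.gain c i = 0 := by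
  simp only [gain, Finset.sum_sub_distrib, ← Nat.cast_sum, sum_countP_colour]
  simp [newEdges, oldEdges]

/-- The colour gains of a bowtie sum to zero, so if one of them is nonzero, then their positive
parts sum to at least one. -/
lemma one_le_sum_max_gain {U : SimpleGraph V} {c : Sym2 V → Fin r} {b : Bowtie V}
    (hb : b.IsGadget U c) : 1 ≤ ∑ i, max 0 (b.gain c i) := by
  obtain ⟨i, hi⟩ := hb.gain_ne
  have hpos : ∃ j, 0 < b.gain c j := by
    by_contra! hcon
    have := (Finset.sum_eq_zero_iff_of_nonpos (fun j _ => hcon j)).1 (sum_gain c b) i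
      (Finset.mem_univ i)
    exact hi this
  obtain ⟨j, hj⟩ := hpos
  have h1 : max 0 (b.gain c j) ≤ ∑ i, max 0 (b.gain c i) :=
    Finset.single_le_sum (f := fun i => max 0 (b.gain c i)) (fun _ _ => le_max_left _ _)
      (Finset.mem_univ j)
  have h2 := le_max_right 0 (b.gain c j)
  omega

lemma Bowtie.mem_verts_of_mem_oldEdges {b : Bowtie V} {e : Sym2 V} (he : e ∈ b.oldEdges) {u : V}
    (hu : u ∈ e) : u ∈ b.verts := by
  simp only [oldEdges, Multiset.insert_eq_cons, Multiset.mem_cons, Multiset.mem_singleton] at he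
  simp only [verts, List.mem_cons, List.not_mem_nil, or_false]
  rcases he with rfl | rfl | rfl <;> rcases Sym2.mem_iff.1 hu with rfl | rfl <;> tauto

/-- Rerouting a Hamilton cycle through those of several disjoint bowties that gain colour `i`. -/
lemma exists_isHam_max_gain [DecidableEq V] {U : SimpleGraph V} (c : Sym2 V → Fin r) (i : Fin r) :
    ∀ (T : List (Bowtie V)), (T.flatMap verts).Nodup → (∀ b ∈ T, b.IsGadget U c) →
    ∀ l, IsHam U l → (∀ b ∈ T, ∀ e ∈ b.oldEdges, e ∈ cycleEdges l) →
    ∃ l', IsHam U l' ∧ ((cycleEdges l).countP (c · = i) : ℤ) +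
      (T.map (fun b => max 0 (b.gain c i))).sum ≤ (cycleEdges l').countP (c · = i)
  | [], _, _, l, hl, _ => ⟨l, hl, by simp⟩
  | b :: T, hnd, hg, l, hl, hold => by
      rw [List.flatMap_cons, List.nodup_append'] at hnd
      obtain ⟨hbnd, hTnd, hdisj⟩ := hnd
      have hgT : ∀ b' ∈ T, b'.IsGadget U c := fun b' hb' => hg b' (List.mem_cons_of_mem _ hb')
      by_cases hpos : b.gain c i ≤ 0
      · obtain ⟨l', hl', hle⟩ := exists_isHam_max_gain c i T hTnd hgT l hl
          (fun b' hb' => hold b' (List.mem_cons_of_mem _ hb'))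
        exact ⟨l', hl', by simpa [max_eq_left hpos] using hle⟩
      · have hb := hg b List.mem_cons_self
        have hbo := hold b List.mem_cons_self
        simp only [oldEdges, Multiset.insert_eq_cons, Multiset.mem_cons, Multiset.mem_singleton,
          forall_eq_or_imp, forall_eq] at hbo
        obtain ⟨l₁, hl₁, heq⟩ := hl.move hb.adj_xy.ne hb.adj_zv.ne hb.adj_vw.ne.symm hbo.1
          hbo.2.1 hbo.2.2 hb.adj_xy hb.adj_zv hb.adj_vw
        change cycleEdges l₁ + b.oldEdges = cycleEdges l + b.newEdges at heq
        obtain ⟨l', hl', hle⟩ := exists_isHam_max_gain c i T hTnd hgT l₁ hl₁ (by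
          intro b' hb' e he
          have h1 : e ∈ cycleEdges l₁ + b.oldEdges := by
            rw [heq]
            exact Multiset.mem_add.2 (Or.inl (hold b' (List.mem_cons_of_mem _ hb') e he))
          rcases Multiset.mem_add.1 h1 with h | h
          · exact h
          · obtain ⟨u, hu⟩ : ∃ u, u ∈ e := ⟨_, e.out_fst_mem⟩
            exact absurd (List.mem_flatMap.2 ⟨b', hb', mem_verts_of_mem_oldEdges he hu⟩)
              (hdisj (mem_verts_of_mem_oldEdges h hu)))
        refine ⟨l', hl', ?_⟩
        have hc := congrArg (Multiset.countP (c · = i)) heq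
        rw [Multiset.countP_add, Multiset.countP_add] at hc
        rw [List.map_cons, List.sum_cons, max_eq_right (by omega)]
        have hgain : b.gain c i = (b.newEdges.countP (c · = i) : ℤ) - b.oldEdges.countP (c · = i) :=
          rfl
        omega

lemma mem_pathEdges_append_left {A B : List V} {e : Sym2 V} (he : e ∈ pathEdges A) :
    e ∈ pathEdges (A ++ B) := by
  by_cases hB : B = []
  · simpa [hB] using he
  have hA : A ≠ [] := by rintro rfl; simp [pathEdges] at he
  simp [pathEdges_append hA hB, he]

lemma mem_pathEdges_append_right {A B : List V} {e : Sym2 V} (he : e ∈ pathEdges B) :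
    e ∈ pathEdges (A ++ B) := by
  by_cases hA : A = []
  · simpa [hA] using he
  have hB : B ≠ [] := by rintro rfl; simp [pathEdges] at he
  simp [pathEdges_append hA hB, he]

lemma mem_pathEdges_flatMap : ∀ {T : List (Bowtie V)} {b : Bowtie V}, b ∈ T → ∀ {e : Sym2 V},
    e ∈ b.oldEdges → e ∈ pathEdges (T.flatMap verts)
  | b' :: T, b, hb, e, he => by
      rw [List.flatMap_cons]
      rcases List.mem_cons.1 hb with rfl | hb
      · refine mem_pathEdges_append_left ?_
        simp only [oldEdges, Multiset.insert_eq_cons, Multiset.mem_cons,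
          Multiset.mem_singleton] at he
        simp only [verts, pathEdges, Multiset.mem_cons]
        tauto
      · exact mem_pathEdges_append_right (mem_pathEdges_flatMap hb he)

/-- Disjoint gadgets give a biased Hamilton cycle: take a Hamilton cycle through all of them, and
for each colour reroute it so as to favour this colour. On average over the colours, the gain is
at least one per gadget. -/
theorem exists_isHam_of_gadgets [Fintype V] [DecidableEq V] {U : SimpleGraph V}
    [DecidableRel U.Adj] (hr : 0 < r) (c : Sym2 V → Fin r) (T : List (Bowtie V))
    (hT : (T.flatMap verts).Nodup) (hg : ∀ b ∈ T, b.IsGadget U c)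
    (hdeg : ∀ v, Fintype.card V + 3 * T.length ≤ 2 * U.degree v) :
    ∃ (i : Fin r) (l : List V), IsHam U l ∧
      Fintype.card V + T.length ≤ r * (cycleEdges l).countP (c · = i) := by
  classical
  set L : Finset (Sym2 V) := (T.flatMap (fun b => [s(b.x, b.v), s(b.v, b.y), s(b.z, b.w)])).toFinset
    with hL
  have hLmem : ∀ e, e ∈ L ↔ ∃ b ∈ T, e ∈ b.oldEdges := by
    intro e
    simp [hL, oldEdges]
  have hLcard : L.card ≤ 3 * T.length := by
    refine (List.toFinset_card_le _).trans ?_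
    simp [List.length_flatMap, mul_comm]
  have hLU : ∀ e ∈ L, e ∈ U.edgeSet := by
    intro e he
    obtain ⟨b, hb, he⟩ := (hLmem e).1 he
    have hb := hg b hb
    simp only [oldEdges, Multiset.insert_eq_cons, Multiset.mem_cons, Multiset.mem_singleton] at he
    rcases he with rfl | rfl | rfl
    · exact hb.adj_xv
    · exact hb.adj_vy
    · exact hb.adj_zw
  set R : List V := (Finset.univ \ (T.flatMap verts).toFinset).toList with hR
  have hord : IsOrder (T.flatMap verts ++ R) := by
    constructor
    · rw [List.nodup_append']
      refine ⟨hT, Finset.nodup_toList _, fun u hu hu' => ?_⟩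
      rw [hR, Finset.mem_toList, Finset.mem_sdiff, List.mem_toFinset] at hu'
      exact hu'.2 hu
    · intro u
      rw [List.mem_append, hR, Finset.mem_toList, Finset.mem_sdiff, List.mem_toFinset]
      simp only [Finset.mem_univ, true_and]
      tauto
  obtain ⟨l, hl, hLl⟩ := exists_isHam_of_degree L hLU (fun v => by have := hdeg v; omega) hord (by
    intro e he
    obtain ⟨b, hb, he⟩ := (hLmem e).1 he
    have h1 := mem_pathEdges_append_left (B := R) (mem_pathEdges_flatMap hb he)
    have hne : T.flatMap verts ++ R ≠ [] := by
      intro h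
      rw [h] at h1
      simp [pathEdges] at h1
    rw [cycleEdges_eq hne]
    exact Multiset.mem_add.2 (Or.inl h1))
  have hmax := fun i => exists_isHam_max_gain c i T hT hg l hl
    (fun b hb e he => hLl e ((hLmem e).2 ⟨b, hb, he⟩))
  choose f hf hcount using hmax
  have hsum : (Fintype.card V : ℤ) + T.length ≤
      ∑ i, ((cycleEdges (f i)).countP (c · = i) : ℤ) := by
    refine le_trans ?_ (Finset.sum_le_sum (fun i _ => hcount i))
    rw [Finset.sum_add_distrib, ← Nat.cast_sum, sum_countP_colour, card_cycleEdges,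
      hl.1.length_eq]
    have : ∀ T : List (Bowtie V), (∀ b ∈ T, b.IsGadget U c) →
        (T.length : ℤ) ≤ ∑ i, (T.map (fun b => max 0 (b.gain c i))).sum := by
      intro T hT
      induction T with
      | nil => simp
      | cons b T ih =>
        simp only [List.map_cons, List.sum_cons, Finset.sum_add_distrib, List.length_cons]
        have h1 := one_le_sum_max_gain (hT b List.mem_cons_self)
        have h2 := ih (fun b' hb' => hT b' (List.mem_cons_of_mem _ hb'))
        push_cast
        omega
    have := this T hg
    omega
  have : Nonempty (Fin r) := ⟨⟨0, hr⟩⟩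
  obtain ⟨i, -, hi⟩ := Finset.exists_max_image Finset.univ
    (fun i => (cycleEdges (f i)).countP (c · = i)) Finset.univ_nonempty
  refine ⟨i, f i, hf i, ?_⟩
  have h2 := Finset.sum_le_card_nsmul Finset.univ
    (fun i => (cycleEdges (f i)).countP (c · = i)) _ hi
  rw [Finset.card_univ, Fintype.card_fin, smul_eq_mul] at h2
  rw [← Nat.cast_sum] at hsum
  have h1 : Fintype.card V + T.length ≤ ∑ i, (cycleEdges (f i)).countP (c · = i) := by
    exact_mod_cast hsum
  exact h1.trans h2

/-- Either there are `k` disjoint gadgets, or at most `5 k` vertices meet all gadgets. -/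
lemma exists_gadgets_or_cover [DecidableEq V] (U : SimpleGraph V) (c : Sym2 V → Fin r) (k : ℕ) :
    (∃ T : List (Bowtie V), T.length = k ∧ (T.flatMap verts).Nodup ∧ ∀ b ∈ T, b.IsGadget U c) ∨
    ∃ D : Finset V, D.card ≤ 5 * k ∧
      ∀ b : Bowtie V, b.IsGadget U c → b.verts.Nodup → ∃ u ∈ b.verts, u ∈ D := by
  induction k with
  | zero => exact Or.inl ⟨[], rfl, by simp, by simp⟩
  | succ k ih =>
    rcases ih with ⟨T, hlen, hnd, hg⟩ | ⟨D, hD, h⟩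
    · by_cases hcov : ∀ b : Bowtie V, b.IsGadget U c → b.verts.Nodup →
          ∃ u ∈ b.verts, u ∈ (T.flatMap verts).toFinset
      · refine Or.inr ⟨(T.flatMap verts).toFinset, (List.toFinset_card_le _).trans ?_, hcov⟩
        rw [List.length_flatMap]
        simp only [verts, List.length_cons, List.length_nil, List.map_const', List.sum_replicate,
          smul_eq_mul]
        omega
      · push Not at hcov
        obtain ⟨b, hb, hbnd, hbT⟩ := hcov
        refine Or.inl ⟨b :: T, by simp [hlen], ?_, ?_⟩
        · rw [List.flatMap_cons, List.nodup_append']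
          exact ⟨hbnd, hnd, fun u hu hu' => hbT u hu (List.mem_toFinset.2 hu')⟩
        · intro b' hb'
          rcases List.mem_cons.1 hb' with rfl | hb'
          · exact hb
          · exact hg b' hb'
    · exact Or.inr ⟨D, by omega, h⟩

end ColourBias

/-! ### Colourings without gadgets -/

namespace ColourBias

open Bowtie

variable {V : Type*} {r : ℕ}

/-- The signed number of edges of colour `i` of the triangle `v x y`, where the edges at `v` count
positively and the opposite edge `x y` negatively. If this does not depend on the triangle, it is
twice a potential `f` on the vertices for which an edge `u v` has colour `i` exactly if
`f u + f v = 1`, and `f u + f v = 0` otherwise. -/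
def triangleSign (c : Sym2 V → Fin r) (i : Fin r) (v x y : V) : ℤ :=
  (if c s(v, x) = i then 1 else 0) + (if c s(v, y) = i then 1 else 0) -
    (if c s(x, y) = i then 1 else 0)

lemma triangleSign_eq_of_no_gadget {U : SimpleGraph V} {c : Sym2 V → Fin r} {v x y z w : V}
    (hno : ¬ (Bowtie.mk v x y z w).IsGadget U c) (hvx : U.Adj v x) (hvy : U.Adj v y)
    (hxy : U.Adj x y) (hvz : U.Adj v z) (hvw : U.Adj v w) (hzw : U.Adj z w) (i : Fin r) :
    triangleSign c i v x y = triangleSign c i v z w := by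
  by_contra hne
  refine hno ⟨hvx.symm, hvy, hxy, hvz.symm, hvw, hzw, i, fun h => hne ?_⟩
  simp only [gain, newEdges, oldEdges, Multiset.insert_eq_cons, Multiset.countP_cons,
    ← Multiset.cons_zero s(v, w), ← Multiset.cons_zero s(z, w), Multiset.countP_zero] at h
  push_cast at h
  simp only [triangleSign]
  rw [Sym2.eq_swap (a := v) (b := x), Sym2.eq_swap (a := v) (b := z)]
  linarith

variable [Fintype V] [DecidableEq V]

/-- The structure of colourings without gadgets. If all gadgets meet a set `D`, then outside `D`
there are an independent set `A` and a colour `s` such that all edges that avoid `A` have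
colour `s`. -/
theorem exists_indep_of_no_gadget [Nonempty V] {U : SimpleGraph V} [DecidableRel U.Adj]
    (c : Sym2 V → Fin r) (D : Finset V)
    (hD : ∀ b : Bowtie V, b.IsGadget U c → b.verts.Nodup → ∃ u ∈ b.verts, u ∈ D)
    (hcommon : ∀ u v, D.card + 5 ≤ (U.neighborFinset u ∩ U.neighborFinset v).card) :
    ∃ (s : Fin r) (A : Finset V), (∀ u ∈ A, ∀ v ∈ A, ¬ U.Adj u v) ∧
      ∀ u v, u ∉ A ∪ D → v ∉ A ∪ D → U.Adj u v → c s(u, v) = s := by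
  have hnbr : ∀ u v : V, ∀ S : Finset V, S.card ≤ 4 →
      ∃ w, U.Adj u w ∧ U.Adj v w ∧ w ∉ D ∧ w ∉ S := by
    intro u v S hS
    have h1 : (D ∪ S).card < (U.neighborFinset u ∩ U.neighborFinset v).card := by
      have := Finset.card_union_le D S
      have := hcommon u v
      omega
    obtain ⟨w, hw, hw'⟩ := Finset.exists_mem_notMem_of_card_lt_card h1
    rw [Finset.mem_inter, SimpleGraph.mem_neighborFinset, SimpleGraph.mem_neighborFinset] at hw
    rw [Finset.mem_union, not_or] at hw'
    exact ⟨w, hw.1, hw.2, hw'.1, hw'.2⟩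
  have hdisj : ∀ v x y z w, v ∉ D → x ∉ D → y ∉ D → z ∉ D → w ∉ D → U.Adj v x → U.Adj v y →
      U.Adj x y → U.Adj v z → U.Adj v w → U.Adj z w → z ≠ x → z ≠ y → w ≠ x → w ≠ y → ∀ i,
      triangleSign c i v x y = triangleSign c i v z w := by
    intro v x y z w hv hx hy hz hw hvx hvy hxy hvz hvw hzw h1 h2 h3 h4 i
    refine triangleSign_eq_of_no_gadget (fun hg => ?_) hvx hvy hxy hvz hvw hzw i
    obtain ⟨u, hu, huD⟩ := hD _ hg (by
      simp only [verts, List.nodup_cons, List.mem_cons, List.not_mem_nil, or_false, not_or,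
        not_false_eq_true, List.nodup_nil, and_true]
      exact ⟨⟨hvx.ne.symm, hxy.ne, h1.symm, h3.symm⟩, ⟨hvy.ne, hvz.ne, hvw.ne⟩,
        ⟨h2.symm, h4.symm⟩, hzw.ne⟩)
    simp only [verts, List.mem_cons, List.not_mem_nil, or_false] at hu
    rcases hu with rfl | rfl | rfl | rfl | rfl <;> contradiction
  -- Two triangles at `v` that are not disjoint outside `v` are compared with a third one.
  have hwell : ∀ v x y z w, v ∉ D → x ∉ D → y ∉ D → z ∉ D → w ∉ D → U.Adj v x → U.Adj v y →
      U.Adj x y → U.Adj v z → U.Adj v w → U.Adj z w → ∀ i,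
      triangleSign c i v x y = triangleSign c i v z w := by
    intro v x y z w hv hx hy hz hw hvx hvy hxy hvz hvw hzw i
    obtain ⟨p, hvp, -, hpD, hp⟩ := hnbr v v {x, y, z, w} Finset.card_le_four
    obtain ⟨q, hvq, hpq, hqD, hq⟩ := hnbr v p {x, y, z, w} Finset.card_le_four
    simp only [Finset.mem_insert, Finset.mem_singleton, not_or] at hp hq
    rw [hdisj v x y p q hv hx hy hpD hqD hvx hvy hxy hvp hvq hpq hp.1 hp.2.1 hq.1 hq.2.1 i,
      hdisj v z w p q hv hz hw hpD hqD hvz hvw hzw hvp hvq hpq hp.2.2.1 hp.2.2.2 hq.2.2.1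
        hq.2.2.2 i]
  have htri : ∀ v, ∃ x y, x ∉ D ∧ y ∉ D ∧ U.Adj v x ∧ U.Adj v y ∧ U.Adj x y := by
    intro v
    obtain ⟨x, hvx, -, hxD, -⟩ := hnbr v v ∅ (by simp)
    obtain ⟨y, hvy, hxy, hyD, -⟩ := hnbr v x ∅ (by simp)
    exact ⟨x, y, hxD, hyD, hvx, hvy, hxy⟩
  choose X Y hX hY hvX hvY hXY using htri
  set φ : Fin r → V → ℤ := fun i v => triangleSign c i v (X v) (Y v) with hφ
  have hφtri : ∀ v x y, v ∉ D → x ∉ D → y ∉ D → U.Adj v x → U.Adj v y → U.Adj x y → ∀ i,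
      φ i v = triangleSign c i v x y := by
    intro v x y hv hx hy hvx hvy hxy i
    exact hwell v _ _ x y hv (hX v) (hY v) hx hy (hvX v) (hvY v) (hXY v) hvx hvy hxy i
  have hφedge : ∀ u v, u ∉ D → v ∉ D → U.Adj u v → ∀ i,
      φ i u + φ i v = 2 * (if c s(u, v) = i then 1 else 0) := by
    intro u v hu hv huv i
    obtain ⟨w, huw, hvw, hw, -⟩ := hnbr u v ∅ (by simp)
    rw [hφtri u v w hu hv hw huv huw hvw, hφtri v u w hv hu hw huv.symm hvw huw]
    simp only [triangleSign, Sym2.eq_swap (a := v) (b := u)]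
    ring
  obtain ⟨v₀, -, -, hv₀, -⟩ := hnbr (Classical.arbitrary V) (Classical.arbitrary V) ∅ (by simp)
  have hsum : ∑ i, φ i v₀ = 1 := by
    simp only [hφ, triangleSign, Finset.sum_sub_distrib, Finset.sum_add_distrib,
      Finset.sum_ite_eq, Finset.mem_univ, if_true]
    norm_num
  obtain ⟨s, hs⟩ : ∃ s, Odd (φ s v₀) := by
    by_contra! hcon
    have : Even (∑ i, φ i v₀) := Finset.even_sum _ (fun i _ => Int.not_odd_iff_even.1 (hcon i))
    rw [hsum] at this
    exact absurd this (by decide)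
  have hodd : ∀ v, v ∉ D → Odd (φ s v) := by
    intro v hv
    obtain ⟨w, h0w, hvw, hw, -⟩ := hnbr v₀ v ∅ (by simp)
    have h1 := hφedge v₀ w hv₀ hw h0w s
    have h2 := hφedge v w hv hw hvw s
    obtain ⟨a, ha⟩ := hs
    refine ⟨a + (if c s(v, w) = s then 1 else 0) - (if c s(v₀, w) = s then 1 else 0), ?_⟩
    linarith
  have hrange : ∀ v, -1 ≤ φ s v ∧ φ s v ≤ 2 := by
    intro v
    simp only [hφ, triangleSign]
    split_ifs <;> norm_num
  refine ⟨s, Finset.univ.filter (fun v => v ∉ D ∧ φ s v = -1), ?_, ?_⟩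
  · intro u hu v hv huv
    rw [Finset.mem_filter] at hu hv
    have := hφedge u v hu.2.1 hv.2.1 huv s
    rw [hu.2.2, hv.2.2] at this
    split_ifs at this <;> omega
  · intro u v hu hv huv
    simp only [Finset.mem_union, Finset.mem_filter, Finset.mem_univ, true_and, not_or,
      not_and] at hu hv
    have hone : ∀ u, u ∉ D → φ s u ≠ -1 → φ s u = 1 := by
      intro u hu hne
      obtain ⟨a, ha⟩ := hodd u hu
      have := hrange u
      omega
    have := hφedge u v hu.2 hv.2 huv s
    rw [hone u hu.2 (hu.1 hu.2), hone v hv.2 (hv.1 hv.2)] at this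
    by_contra hne
    rw [if_neg hne] at this
    norm_num at this

/-- The sum of the values of `f` at the two ends of an edge. -/
def edgeSum {V : Type*} (f : V → ℕ) : Sym2 V → ℕ :=
  Sym2.lift ⟨fun u v => f u + f v, fun u v => add_comm (f u) (f v)⟩

omit [Fintype V] [DecidableEq V] in
@[simp]
lemma edgeSum_mk (f : V → ℕ) (u v : V) : edgeSum f s(u, v) = f u + f v := rfl

omit [Fintype V] [DecidableEq V] in
lemma sum_edgeSum_pathEdges (f : V → ℕ) : ∀ (l : List V) (a : V),
    ((pathEdges (a :: l)).map (edgeSum f)).sum + f a + f ((a :: l).getLast (by simp)) =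
      2 * ((a :: l).map f).sum
  | [], a => by simp [pathEdges]; ring
  | b :: l, a => by
      have h := sum_edgeSum_pathEdges f l b
      simp only [pathEdges, Multiset.map_cons, Multiset.sum_cons, edgeSum_mk, List.map_cons,
        List.sum_cons, List.getLast_cons_cons] at h ⊢
      omega

omit [Fintype V] [DecidableEq V] in
lemma sum_edgeSum_cycleEdges (f : V → ℕ) : ∀ l : List V,
    ((cycleEdges l).map (edgeSum f)).sum = 2 * (l.map f).sum
  | [] => by simp [cycleEdges]
  | a :: l => by
      rw [← sum_edgeSum_pathEdges f l a]
      simp only [cycleEdges, Multiset.map_add, Multiset.sum_add, Multiset.map_singleton,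
        Multiset.sum_singleton, edgeSum_mk]
      ring

lemma countP_le_sum_map {α : Type*} (p : α → Prop) [DecidablePred p] (g : α → ℕ)
    (h : ∀ a, p a → 1 ≤ g a) (s : Multiset α) : s.countP p ≤ (s.map g).sum := by
  induction s using Multiset.induction with
  | empty => simp
  | cons a s ih =>
    rw [Multiset.countP_cons, Multiset.map_cons, Multiset.sum_cons]
    have := h a
    split_ifs with hp
    · have := this hp; omega
    · omega

/-- A cyclic order has at most two edges at each vertex of `S`. -/
lemma card_le_countP_add (S : Finset V) {l : List V} (hl : IsOrder l) (p : Sym2 V → Prop)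
    [DecidablePred p] (hp : ∀ u v, s(u, v) ∈ cycleEdges l → u ∉ S → v ∉ S → p s(u, v)) :
    Fintype.card V ≤ (cycleEdges l).countP p + 2 * S.card := by
  set f : V → ℕ := fun v => if v ∈ S then 1 else 0 with hf
  have h1 : (cycleEdges l).countP (fun e => 1 ≤ edgeSum f e) ≤ 2 * S.card := by
    refine (countP_le_sum_map _ _ (fun _ h => h) _).trans ?_
    rw [sum_edgeSum_cycleEdges, ← List.sum_toFinset f hl.1]
    have : l.toFinset = Finset.univ := by ext v; simp [hl.2 v]
    rw [this]
    simp [hf]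
  have h2 := Multiset.card_eq_countP_add_countP (fun e => 1 ≤ edgeSum f e) (cycleEdges l)
  have h3 : (cycleEdges l).countP (fun e => ¬ 1 ≤ edgeSum f e) ≤ (cycleEdges l).countP p := by
    rw [Multiset.countP_eq_card_filter, Multiset.countP_eq_card_filter]
    refine Multiset.card_le_card ?_
    rw [Multiset.le_filter]
    refine ⟨Multiset.filter_le _ _, fun e he => ?_⟩
    obtain ⟨he, hne⟩ := Multiset.mem_filter.1 he
    induction e with
    | _ u v =>
      simp only [edgeSum_mk, hf] at hne
      refine hp u v he ?_ ?_
      · intro hu; rw [if_pos hu] at hne; omega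
      · intro hv; rw [if_pos hv] at hne; omega
  rw [card_cycleEdges, hl.length_eq] at h2
  omega

/-- A colouring of the edges of `U`, extended to all pairs of vertices in an arbitrary way. -/
noncomputable def extendColouring {V : Type*} (hr : 0 < r) {U : SimpleGraph V} (χ : Colouring r U)
    (e : Sym2 V) : Fin r :=
  open scoped Classical in if h : e ∈ U.edgeSet then χ ⟨e, h⟩ else ⟨0, hr⟩

omit [Fintype V] in
lemma colourCount_eq_countP (hr : 0 < r) {U : SimpleGraph V} (χ : Colouring r U) {v : V}
    {p : U.Walk v v} (hp : p.edges.Nodup) (i : Fin r) :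
    colourCount χ p i =
      (p.edges : Multiset (Sym2 V)).countP (extendColouring hr χ · = i) := by
  have h : ((↑) : U.edgeSet → Sym2 V) '' {e : U.edgeSet | (e : Sym2 V) ∈ p.edges ∧ χ e = i} =
      ((p.edges.toFinset.filter (extendColouring hr χ · = i) : Finset (Sym2 V)) :
        Set (Sym2 V)) := by
    ext e
    simp only [Set.mem_image, Set.mem_ofPred_eq, Subtype.exists, exists_and_right,
      exists_eq_right, Finset.coe_filter, List.mem_toFinset]
    constructor
    · rintro ⟨he, he', rfl⟩
      exact ⟨he', by simp [extendColouring, he]⟩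
    · rintro ⟨he', rfl⟩
      have he := p.edges_subset_edgeSet he'
      exact ⟨he, he', by simp [extendColouring, he]⟩
  rw [colourCount, ← Set.ncard_image_of_injective _ Subtype.val_injective, h,
    Set.ncard_coe_finset, Finset.card_def, Finset.filter_val, List.toFinset_val, hp.dedup,
    Multiset.countP_eq_card_filter]

omit [DecidableEq V] in
lemma le_bias {U : SimpleGraph V} (χ : Colouring r U) {v : V} (p : U.Walk v v) (i : Fin r) :
    (colourCount χ p i : ℝ) - (Fintype.card V : ℝ) / r ≤ bias χ p :=
  le_ciSup (f := fun i => (colourCount χ p i : ℝ) - (Fintype.card V : ℝ) / r)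
    (Set.finite_range _).bddAbove i

/-- A Hamiltonian cyclic order with many edges of one colour is a biased Hamilton cycle. -/
lemma IsHam.exists_walk_le_bias (hr : 0 < r) {U : SimpleGraph V} (χ : Colouring r U)
    (hV : 3 ≤ Fintype.card V) {l : List V} (hl : IsHam U l) {i : Fin r} {k : ℕ}
    (h : Fintype.card V + k ≤ r * (cycleEdges l).countP (extendColouring hr χ · = i)) :
    ∃ (v : V) (p : U.Walk v v), p.IsHamiltonianCycle ∧ (k : ℝ) / r ≤ bias χ p := by
  obtain ⟨v, p, hp, hpe⟩ := hl.exists_walk hV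
  refine ⟨v, p, hp, le_trans ?_ (le_bias χ p i)⟩
  rw [colourCount_eq_countP hr χ hp.isCycle.isTrail.edges_nodup, hpe]
  have hr' : (0 : ℝ) < r := by exact_mod_cast hr
  have h' : (Fintype.card V : ℝ) + k ≤
      r * ((cycleEdges l).countP (extendColouring hr χ · = i) : ℕ) := by exact_mod_cast h
  rw [le_sub_iff_add_le, ← add_div, div_le_iff₀ hr']
  linarith

/-- The deterministic core of the lower bound: if every vertex of `U` has degree at least
`(r + 1) n / (2 r)`, then an `r`-colouring of `U` without a Hamilton cycle of bias `k / r` forces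
an independent set with almost `(r - 1) n / (2 r)` vertices. -/
theorem exists_biased_or_indep (hr : 0 < r) {U : SimpleGraph V} [DecidableRel U.Adj] {k : ℕ}
    (hdeg : ∀ v, (r + 1) * Fintype.card V ≤ 2 * r * U.degree v)
    (hk : r * (5 * k + 5) ≤ Fintype.card V) (χ : Colouring r U) :
    (∃ (v : V) (p : U.Walk v v), p.IsHamiltonianCycle ∧ (k : ℝ) / r ≤ bias χ p) ∨
    ∃ A : Finset V, (∀ u ∈ A, ∀ v ∈ A, ¬ U.Adj u v) ∧
      r * Fintype.card V ≤ Fintype.card V + 2 * r * A.card + 11 * r * k := by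
  set n := Fintype.card V with hn
  have hrk : 5 * (r * k) + 5 * r ≤ n := by linarith
  have hV : 3 ≤ Fintype.card V := by omega
  have hdeg' : ∀ v, n + (5 * k + 5) ≤ 2 * U.degree v := by
    intro v
    refine Nat.le_of_mul_le_mul_left ?_ hr
    have := hdeg v
    nlinarith
  have : Nonempty V := Fintype.card_pos_iff.1 (by omega)
  rcases exists_gadgets_or_cover U (extendColouring hr χ) k with ⟨T, hlen, hnd, hg⟩ | ⟨D, hD, hcov⟩
  · obtain ⟨i, l, hl, hcount⟩ := exists_isHam_of_gadgets hr _ T hnd hg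
      (fun v => by have := hdeg' v; omega)
    rw [hlen] at hcount
    exact Or.inl (hl.exists_walk_le_bias hr χ hV hcount)
  · obtain ⟨s, A, hA, hs⟩ := exists_indep_of_no_gadget (extendColouring hr χ) D hcov (by
      intro u v
      have h1 := Finset.card_union_add_card_inter (U.neighborFinset u) (U.neighborFinset v)
      rw [SimpleGraph.card_neighborFinset_eq_degree, SimpleGraph.card_neighborFinset_eq_degree] at h1
      have h2 := Finset.card_le_univ (U.neighborFinset u ∪ U.neighborFinset v)
      have := hdeg' u
      have := hdeg' v
      omega)
    have hord : IsOrder (Finset.univ : Finset V).toList := ⟨Finset.nodup_toList _, by simp⟩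
    obtain ⟨l, hl, -⟩ := exists_isHam_of_degree (G := U) ∅ (by simp)
      (fun v => by have := hdeg' v; rw [Finset.card_empty]; omega) hord (by simp)
    have hcount := card_le_countP_add (A ∪ D) hl.1 (extendColouring hr χ · = s)
      (fun u v huv hu hv => hs u v hu hv (hl.2 _ huv))
    have hAD := Finset.card_union_le A D
    by_cases hbig : n + k ≤ r * (cycleEdges l).countP (extendColouring hr χ · = s)
    · exact Or.inl (hl.exists_walk_le_bias hr χ hV hbig)
    · refine Or.inr ⟨A, hA, ?_⟩
      have h1 : r * n ≤ r * ((cycleEdges l).countP (extendColouring hr χ · = s) +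
          2 * (A.card + 5 * k)) := Nat.mul_le_mul_left r (by omega)
      have h2 : k ≤ r * k := Nat.le_mul_of_pos_left k hr
      nlinarith

end ColourBias

/-! ### Independent sets, and counting edge sets with small covers -/

namespace ColourBias

section Families

variable {V : Type*} [Fintype V] [DecidableEq V]

/-- Large independent sets of a graph with large minimum degree come in few types: there are at
most five of them such that each of them contains one of these five up to `6 k` vertices.
Indeed, two large independent sets that share a vertex `v` both nearly exhaust the
complement of the neighbourhood of `v`, so a maximal disjoint family has this property. -/
lemma exists_representative_indep {r k : ℕ} (hr : 2 ≤ r) {G : SimpleGraph V} [DecidableRel G.Adj]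
    (hdeg : ∀ v, (r + 1) * Fintype.card V ≤ 2 * r * G.degree v)
    (hk : 110 * k ≤ Fintype.card V) (hV : 0 < Fintype.card V) :
    ∃ 𝓘 : Finset (Finset V), 𝓘.card ≤ 5 ∧ (∀ I ∈ 𝓘, Fintype.card V ≤ 5 * I.card) ∧
      ∀ A : Finset V, (∀ u ∈ A, ∀ v ∈ A, ¬ G.Adj u v) →
        r * Fintype.card V ≤ Fintype.card V + 2 * r * A.card + 11 * r * k →
        ∃ I ∈ 𝓘, (I \ A).card ≤ 6 * k := by
  classical
  set n := Fintype.card V with hn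
  set good : Finset V → Prop := fun A => (∀ u ∈ A, ∀ v ∈ A, ¬ G.Adj u v) ∧
    r * n ≤ n + 2 * r * A.card + 11 * r * k with hgood
  have hlarge : ∀ A, good A → n ≤ 5 * A.card := by
    intro A hA
    have h1 := hA.2
    have h2 : 2 * n ≤ r * n := Nat.mul_le_mul_right n hr
    have h3 : r * (110 * k) ≤ r * n := Nat.mul_le_mul_left r hk
    have h4 : r * n ≤ r * (5 * A.card) := by nlinarith
    exact Nat.le_of_mul_le_mul_left h4 (by omega)
  set 𝓢 : Finset (Finset (Finset V)) := Finset.univ.filter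
    (fun 𝓘 => (∀ I ∈ 𝓘, good I) ∧ (𝓘 : Set (Finset V)).PairwiseDisjoint id) with h𝓢
  obtain ⟨𝓘, h𝓘, hmax⟩ := Finset.exists_max_image 𝓢 Finset.card
    ⟨∅, by simp [h𝓢]⟩
  rw [h𝓢, Finset.mem_filter] at h𝓘
  obtain ⟨-, hgoodI, hdisj⟩ := h𝓘
  refine ⟨𝓘, ?_, fun I hI => hlarge I (hgoodI I hI), ?_⟩
  · have h1 : ∑ I ∈ 𝓘, I.card ≤ n := by
      have := Finset.card_biUnion (s := 𝓘) (t := id) hdisj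
      simp only [id] at this
      rw [← this]
      exact Finset.card_le_univ _
    have h2 : 𝓘.card * n ≤ ∑ I ∈ 𝓘, 5 * I.card := by
      rw [← smul_eq_mul]
      exact Finset.card_nsmul_le_sum _ _ _ (fun I hI => hlarge I (hgoodI I hI))
    rw [← Finset.mul_sum] at h2
    exact Nat.le_of_mul_le_mul_right (h2.trans (Nat.mul_le_mul_left 5 h1)) hV
  · intro A hAind hAcard
    have hA : good A := ⟨hAind, hAcard⟩
    have hAne : A.Nonempty := by
      rw [← Finset.card_pos]
      have := hlarge A hA
      omega
    obtain ⟨I, hI, hIA⟩ : ∃ I ∈ 𝓘, ¬ Disjoint I A := by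
      by_contra! hcon
      have hA𝓘 : A ∉ 𝓘 := fun h => hAne.ne_empty (disjoint_self.1 (hcon A h))
      have := hmax (insert A 𝓘) (by
        rw [h𝓢, Finset.mem_filter]
        refine ⟨Finset.mem_univ _, ?_, ?_⟩
        · intro I hI
          rcases Finset.mem_insert.1 hI with rfl | hI
          · exact hA
          · exact hgoodI I hI
        · rw [Finset.coe_insert]
          exact hdisj.insert (fun I hI _ => (hcon I hI).symm))
      rw [Finset.card_insert_of_notMem hA𝓘] at this
      omega
    refine ⟨I, hI, ?_⟩
    obtain ⟨v, hvI, hvA⟩ := Finset.not_disjoint_iff.1 hIA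
    have h1 : (I ∪ A).card + G.degree v ≤ n := by
      rw [← SimpleGraph.card_neighborFinset_eq_degree, ← Finset.card_union_of_disjoint]
      · exact Finset.card_le_univ _
      · rw [Finset.disjoint_left]
        intro u hu huv
        rw [SimpleGraph.mem_neighborFinset] at huv
        rcases Finset.mem_union.1 hu with hu | hu
        · exact (hgoodI I hI).1 v hvI u hu huv
        · exact hAind v hvA u hu huv
    have h2 : (I \ A).card + A.card = (I ∪ A).card := Finset.card_sdiff_add_card I A
    have h3 := hdeg v
    have h4 : 2 * r * ((I \ A).card + A.card + G.degree v) ≤ 2 * r * n :=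
      Nat.mul_le_mul_left _ (by omega)
    have h5 : r * (2 * (I \ A).card) ≤ r * (11 * k) := by nlinarith
    have := Nat.le_of_mul_le_mul_left h5 (by omega)
    omega

end Families

section Counting

lemma choose_mul_pow_le {a b : ℕ} (hab : 40 * a ≤ 39 * b) (t : ℕ) :
    a.choose t * 40 ^ t ≤ 39 ^ t * b.choose t := by
  induction t with
  | zero => simp
  | succ t ih =>
    refine Nat.le_of_mul_le_mul_right ?_ (Nat.succ_pos t)
    have h1 := Nat.choose_succ_right_eq a t
    have h2 := Nat.choose_succ_right_eq b t
    calc a.choose (t + 1) * 40 ^ (t + 1) * (t + 1)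
        = (a.choose t * 40 ^ t) * (40 * (a - t)) := by
          rw [show a.choose (t + 1) * 40 ^ (t + 1) * (t + 1) =
            (a.choose (t + 1) * (t + 1)) * 40 ^ (t + 1) by ring, h1]
          ring
      _ ≤ (39 ^ t * b.choose t) * (39 * (b - t)) := Nat.mul_le_mul ih (by omega)
      _ = 39 ^ (t + 1) * b.choose (t + 1) * (t + 1) := by
          rw [show 39 ^ (t + 1) * b.choose (t + 1) * (t + 1) =
            39 ^ (t + 1) * (b.choose (t + 1) * (t + 1)) by ring, h2]
          ring

lemma choose_le_pow (m j : ℕ) : (m.choose j : ℝ) ≤ 100 ^ j * (101 / 100) ^ m := by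
  by_cases hj : j ≤ m
  · have h : (1 / 100 : ℝ) ^ j * 1 ^ (m - j) * m.choose j ≤ (1 / 100 + 1) ^ m := by
      rw [add_pow]
      exact Finset.single_le_sum
        (f := fun j => (1 / 100 : ℝ) ^ j * 1 ^ (m - j) * m.choose j)
        (fun i _ => by positivity) (Finset.mem_range.2 (by omega))
    rw [one_pow, mul_one, show (1 / 100 + 1 : ℝ) = 101 / 100 by norm_num] at h
    calc (m.choose j : ℝ) = 100 ^ j * ((1 / 100 : ℝ) ^ j * m.choose j) := by
          rw [← mul_assoc, ← mul_pow]; norm_num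
      _ ≤ _ := by gcongr
  · rw [Nat.choose_eq_zero_of_lt (by omega)]
    simp only [Nat.cast_zero]
    positivity

/-- A union bound over witnesses: few `m`-subsets `E` of `P` contain a set `M` of at most `q`
elements for which `E` avoids a set `K M` containing a positive proportion of `P`. The number of
choices for `M` is compensated by the fact that `E` has to contain `M`. -/
lemma card_avoiding_le {α : Type*} [DecidableEq α] (P : Finset α) (K : Finset α → Finset α)
    {m q : ℕ} (hqm : q ≤ m) (hmN : m ≤ P.card)
    (hK : ∀ M, M ⊆ P → M.card ≤ q → K M ⊆ P ∧ Disjoint M (K M) ∧ P.card ≤ 40 * (K M).card)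
    (𝓑 : Finset (Finset α)) (h𝓑 : ∀ E ∈ 𝓑, E ⊆ P ∧ E.card = m ∧
      ∃ M ⊆ E, M.card ≤ q ∧ Disjoint E (K M)) :
    (𝓑.card : ℝ) ≤ (P.card.choose m) * ((q + 1) * 103 ^ q * (197 / 200) ^ m) := by
  set N := P.card with hN
  have hsub : 𝓑 ⊆ (Finset.range (q + 1)).biUnion (fun j => (P.powersetCard j).biUnion
      (fun M => ((P \ (M ∪ K M)).powersetCard (m - j)).image (M ∪ ·))) := by
    intro E hE
    obtain ⟨hEP, hEm, M, hME, hMq, hdis⟩ := h𝓑 E hE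
    simp only [Finset.mem_biUnion, Finset.mem_range, Finset.mem_powersetCard, Finset.mem_image]
    refine ⟨M.card, by omega, M, ⟨hME.trans hEP, rfl⟩, E \ M, ⟨?_, ?_⟩,
      Finset.union_sdiff_of_subset hME⟩
    · intro e he
      rw [Finset.mem_sdiff] at he ⊢
      refine ⟨hEP he.1, fun h => ?_⟩
      rcases Finset.mem_union.1 h with h | h
      · exact he.2 h
      · exact Finset.disjoint_left.1 hdis he.1 h
    · rw [Finset.card_sdiff_of_subset hME, hEm]
  have hterm : ∀ j ∈ Finset.range (q + 1), ∀ M ∈ P.powersetCard j,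
      (((((P \ (M ∪ K M)).powersetCard (m - j)).image (M ∪ ·)).card : ℕ) : ℝ) ≤
        (39 / 40) ^ (m - j) * (N - j).choose (m - j) := by
    intro j hj M hM
    rw [Finset.mem_range] at hj
    obtain ⟨hMP, hMj⟩ := Finset.mem_powersetCard.1 hM
    obtain ⟨hKP, hMK, hKN⟩ := hK M hMP (by omega)
    have hcard : (P \ (M ∪ K M)).card = N - (j + (K M).card) := by
      rw [Finset.card_sdiff_of_subset (Finset.union_subset hMP hKP),
        Finset.card_union_of_disjoint hMK, hMj]
    have h1 := choose_mul_pow_le (a := (P \ (M ∪ K M)).card) (b := N - j) (by omega) (m - j)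
    have h2 : ((P \ (M ∪ K M)).card.choose (m - j) : ℝ) * 40 ^ (m - j) ≤
        39 ^ (m - j) * (N - j).choose (m - j) := by exact_mod_cast h1
    have h3 : ((((P \ (M ∪ K M)).powersetCard (m - j)).image (M ∪ ·)).card : ℝ) ≤
        (P \ (M ∪ K M)).card.choose (m - j) := by
      rw [← Finset.card_powersetCard]
      exact_mod_cast Finset.card_image_le
    refine h3.trans ?_
    rw [div_pow, div_mul_eq_mul_div, le_div_iff₀ (by positivity)]
    exact h2
  have hj : ∀ j ∈ Finset.range (q + 1),
      ((((P.powersetCard j).biUnion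
        (fun M => ((P \ (M ∪ K M)).powersetCard (m - j)).image (M ∪ ·))).card : ℕ) : ℝ) ≤
        N.choose m * (103 ^ q * (197 / 200) ^ m) := by
    intro j hj
    have hjm : j ≤ m := by rw [Finset.mem_range] at hj; omega
    have hjq : j ≤ q := by rw [Finset.mem_range] at hj; omega
    have h1 : ((((P.powersetCard j).biUnion
        (fun M => ((P \ (M ∪ K M)).powersetCard (m - j)).image (M ∪ ·))).card : ℕ) : ℝ) ≤
        ∑ M ∈ P.powersetCard j, (39 / 40 : ℝ) ^ (m - j) * (N - j).choose (m - j) := by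
      refine le_trans ?_ (Finset.sum_le_sum (hterm j hj))
      exact_mod_cast Finset.card_biUnion_le
    refine h1.trans ?_
    rw [Finset.sum_const, Finset.card_powersetCard, nsmul_eq_mul, ← hN]
    have h2 : (N.choose j : ℝ) * (N - j).choose (m - j) = N.choose m * m.choose j := by
      exact_mod_cast (Nat.choose_mul hjm).symm
    calc (N.choose j : ℝ) * ((39 / 40) ^ (m - j) * (N - j).choose (m - j))
        = N.choose m * (m.choose j * (39 / 40) ^ (m - j)) := by
          linear_combination (39 / 40 : ℝ) ^ (m - j) * h2
      _ ≤ N.choose m * (103 ^ q * (197 / 200) ^ m) := by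
          gcongr ?_ * ?_
          have h3 : (39 / 40 : ℝ) ^ (m - j) = (39 / 40) ^ m * (40 / 39) ^ j := by
            conv_rhs => rw [← Nat.sub_add_cancel hjm, pow_add, mul_assoc, ← mul_pow]
            norm_num
          -- `103` bounds `100 * (40 / 39)`, and `197 / 200` bounds `(101 / 100) * (39 / 40)`.
          calc (m.choose j : ℝ) * (39 / 40) ^ (m - j)
              ≤ (100 ^ j * (101 / 100) ^ m) * ((39 / 40) ^ m * (40 / 39) ^ j) := by
                rw [h3]; gcongr; exact choose_le_pow m j
            _ = (100 * (40 / 39)) ^ j * ((101 / 100) * (39 / 40)) ^ m := by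
                rw [mul_pow, mul_pow]; ring
            _ ≤ 103 ^ j * (197 / 200) ^ m := by gcongr <;> norm_num
            _ ≤ 103 ^ q * (197 / 200) ^ m := by gcongr; norm_num
  calc (𝓑.card : ℝ)
      ≤ ((((Finset.range (q + 1)).biUnion (fun j => (P.powersetCard j).biUnion
          (fun M => ((P \ (M ∪ K M)).powersetCard (m - j)).image (M ∪ ·)))).card : ℕ) : ℝ) := by
        exact_mod_cast Finset.card_le_card hsub
    _ ≤ ∑ j ∈ Finset.range (q + 1), ((((P.powersetCard j).biUnion
        (fun M => ((P \ (M ∪ K M)).powersetCard (m - j)).image (M ∪ ·))).card : ℕ) : ℝ) := by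
        exact_mod_cast Finset.card_biUnion_le
    _ ≤ ∑ j ∈ Finset.range (q + 1), (N.choose m : ℝ) * (103 ^ q * (197 / 200) ^ m) :=
        Finset.sum_le_sum hj
    _ = _ := by
        rw [Finset.sum_const, Finset.card_range, nsmul_eq_mul]
        push_cast
        ring

variable {V : Type*} [Fintype V] [DecidableEq V]

/-- Few sets of `m` edges are such that the edges inside the large set `I` can be covered by few
vertices. A set `R` of covering vertices is encoded by a set `M` of at most `|R|` edges, one at
each vertex of `R` that lies on such an edge; then no edge lies inside `I` without meeting `M`. -/
lemma card_coverable_le {m k : ℕ} (hkm : 6 * k ≤ m)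
    (hmV : m ≤ (Fintype.card V).choose 2) (hkV : 720 * k ≤ Fintype.card V)
    (hV : 40 ≤ Fintype.card V) (I : Finset V) (hI : Fintype.card V ≤ 5 * I.card)
    (𝓑 : Finset (Finset (Sym2 V))) (h𝓑 : ∀ E ∈ 𝓑, E ⊆ (⊤ : SimpleGraph V).edgeFinset ∧
      E.card = m ∧ ∃ R : Finset V, R.card ≤ 6 * k ∧
        ∀ e ∈ E, (∀ v ∈ e, v ∈ I) → ∃ v ∈ e, v ∈ R) :
    (𝓑.card : ℝ) ≤ ((Fintype.card V).choose 2).choose m *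
      ((6 * k + 1) * 103 ^ (6 * k) * (197 / 200) ^ m) := by
  classical
  have hP : (⊤ : SimpleGraph V).edgeFinset.card = (Fintype.card V).choose 2 :=
    SimpleGraph.card_edgeFinset_top_eq_card_choose_two
  set X : Finset (Sym2 V) → Finset V := fun M => M.biUnion Sym2.toFinset with hX
  have hXmem : ∀ M v, v ∈ X M ↔ ∃ e ∈ M, v ∈ e := by
    intro M v
    simp [hX]
  set K : Finset (Sym2 V) → Finset (Sym2 V) := fun M => (I \ X M).offDiag.image Sym2.mk.uncurry
    with hKdef
  have hKmem : ∀ M e, e ∈ K M → ∀ v ∈ e, v ∈ I ∧ v ∉ X M := by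
    intro M e he v hv
    simp only [hKdef, Finset.mem_image, Finset.mem_offDiag, Prod.exists, Finset.mem_sdiff] at he
    obtain ⟨a, b, ⟨ha, hb, -⟩, rfl⟩ := he
    rcases Sym2.mem_iff.1 hv with rfl | rfl
    · exact ha
    · exact hb
  have := card_avoiding_le (⊤ : SimpleGraph V).edgeFinset K hkm (hP ▸ hmV) ?_ 𝓑 ?_
  · rw [hP] at this
    exact_mod_cast this
  · intro M hM hMq
    refine ⟨?_, ?_, ?_⟩
    · intro e he
      simp only [hKdef, Finset.mem_image, Finset.mem_offDiag, Prod.exists] at he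
      obtain ⟨a, b, ⟨-, -, hab⟩, rfl⟩ := he
      rw [SimpleGraph.mem_edgeFinset]
      exact hab
    · rw [Finset.disjoint_left]
      intro e he heK
      exact (hKmem M e heK _ e.out_fst_mem).2 ((hXmem M _).2 ⟨e, he, e.out_fst_mem⟩)
    · have h1 : (X M).card ≤ 2 * M.card := by
        refine Finset.card_biUnion_le.trans ?_
        rw [mul_comm, ← smul_eq_mul]
        refine Finset.sum_le_card_nsmul _ _ _ (fun e _ => ?_)
        rw [Sym2.card_toFinset]
        split_ifs <;> omega
      have h2 := Finset.le_card_sdiff (X M) I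
      have h3 : (K M).card = ((I \ X M).card).choose 2 := Sym2.card_image_offDiag _
      rw [hP, h3]
      set n := Fintype.card V
      set s := (I \ X M).card
      have h4 : 11 * n ≤ 60 * s := by omega
      have h5 : (n.choose 2 : ℝ) ≤ 40 * (s.choose 2 : ℝ) := by
        rw [Nat.cast_choose_two, Nat.cast_choose_two]
        have h4' : (11 * n : ℝ) ≤ 60 * s := by exact_mod_cast h4
        have h6 : (40 : ℝ) ≤ n := by exact_mod_cast hV
        nlinarith
      exact_mod_cast h5
  · intro E hE
    obtain ⟨hEP, hEm, R, hR, hcov⟩ := h𝓑 E hE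
    set R' := R.filter (fun v => ∃ e ∈ E, v ∈ e) with hR'
    have hch : ∀ v : V, ∃ e : Sym2 V, v ∈ R' → e ∈ E ∧ v ∈ e := by
      intro v
      by_cases hv : v ∈ R'
      · obtain ⟨e, he, hve⟩ := (Finset.mem_filter.1 hv).2
        exact ⟨e, fun _ => ⟨he, hve⟩⟩
      · exact ⟨s(v, v), fun h => absurd h hv⟩
    choose g hg using hch
    refine ⟨hEP, hEm, R'.image g, ?_, ?_, ?_⟩
    · intro e he
      obtain ⟨v, hv, rfl⟩ := Finset.mem_image.1 he
      exact (hg v hv).1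
    · exact Finset.card_image_le.trans ((Finset.card_filter_le _ _).trans hR)
    · rw [Finset.disjoint_left]
      intro e he heK
      obtain ⟨v, hve, hvR⟩ := hcov e he (fun v hv => (hKmem _ e heK v hv).1)
      have hvR' : v ∈ R' := Finset.mem_filter.2 ⟨hvR, e, he, hve⟩
      exact (hKmem _ e heK v hve).2
        ((hXmem _ _).2 ⟨g v, Finset.mem_image_of_mem g hvR', (hg v hvR').2⟩)

end Counting

end ColourBias

/-! ### The random graph -/

namespace ColourBias

lemma finite_withEdges (n m : ℕ) : (withEdges n m).Finite := Set.toFinite _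

open scoped Classical in
lemma image_edgeFinset_withEdges (n m : ℕ) :
    (fun F : SimpleGraph (Fin n) => F.edgeFinset) '' withEdges n m =
      (((⊤ : SimpleGraph (Fin n)).edgeFinset.powersetCard m : Finset (Finset (Sym2 (Fin n)))) :
        Set (Finset (Sym2 (Fin n)))) := by
  ext E
  simp only [Set.mem_image, withEdges, Set.mem_ofPred_eq, Finset.mem_coe, Finset.mem_powersetCard]
  constructor
  · rintro ⟨F, hF, rfl⟩
    refine ⟨?_, ?_⟩
    · exact SimpleGraph.edgeFinset_mono le_top
    · rw [← hF, ← SimpleGraph.coe_edgeFinset, Set.ncard_coe_finset]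
  · rintro ⟨hE, hEm⟩
    have hEs : (SimpleGraph.fromEdgeSet (E : Set (Sym2 (Fin n)))).edgeSet = E := by
      rw [SimpleGraph.edgeSet_fromEdgeSet, sdiff_eq_left, Set.disjoint_left]
      intro e he hd
      have := hE he
      rw [SimpleGraph.mem_edgeFinset] at this
      exact SimpleGraph.not_isDiag_of_mem_edgeSet _ this hd
    refine ⟨SimpleGraph.fromEdgeSet (E : Set (Sym2 (Fin n))), ?_, ?_⟩
    · rw [hEs, Set.ncard_coe_finset, hEm]
    · apply Finset.coe_injective
      rw [SimpleGraph.coe_edgeFinset, hEs]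

open scoped Classical in
lemma edgeFinset_injective (n : ℕ) :
    Function.Injective (fun F : SimpleGraph (Fin n) => F.edgeFinset) :=
  fun _ _ h => SimpleGraph.edgeFinset_inj.1 h

lemma ncard_withEdges (n m : ℕ) : (withEdges n m).ncard = (n.choose 2).choose m := by
  classical
  rw [← Set.ncard_image_of_injective _ (edgeFinset_injective n), image_edgeFinset_withEdges,
    Set.ncard_coe_finset, Finset.card_powersetCard,
    SimpleGraph.card_edgeFinset_top_eq_card_choose_two, Fintype.card_fin]

lemma gnmProb_mono {n m : ℕ} {S T : Set (SimpleGraph (Fin n))} (h : S ⊆ T) :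
    gnmProb n m S ≤ gnmProb n m T := by
  unfold gnmProb
  gcongr
  exact (finite_withEdges n m).subset Set.inter_subset_left

lemma gnmProb_le_one (n m : ℕ) (S : Set (SimpleGraph (Fin n))) : gnmProb n m S ≤ 1 := by
  unfold gnmProb
  refine div_le_one_of_le₀ ?_ (by positivity)
  exact_mod_cast Set.ncard_le_ncard Set.inter_subset_left (finite_withEdges n m)

lemma one_sub_le_gnmProb {n m : ℕ} (hm : m ≤ n.choose 2) {S : Set (SimpleGraph (Fin n))} {ε : ℝ}
    (h : ((withEdges n m \ S).ncard : ℝ) ≤ (n.choose 2).choose m * ε) :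
    1 - ε ≤ gnmProb n m S := by
  have hpos : (0 : ℝ) < (n.choose 2).choose m := by exact_mod_cast Nat.choose_pos hm
  have h1 := Set.ncard_inter_add_ncard_sdiff_eq_ncard (withEdges n m) S (finite_withEdges n m)
  rw [ncard_withEdges] at h1
  have h2 : ((withEdges n m ∩ S).ncard : ℝ) + (withEdges n m \ S).ncard =
      (n.choose 2).choose m := by exact_mod_cast h1
  rw [gnmProb, ncard_withEdges, le_div_iff₀ hpos]
  linarith

lemma UnionWhp.mono {G : ∀ n, SimpleGraph (Fin n)} {m : ℕ → ℕ}
    {P Q : ∀ n, SimpleGraph (Fin n) → Prop} (h : UnionWhp G m P)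
    (hPQ : ∀ᶠ n in atTop, ∀ U, P n U → Q n U) : UnionWhp G m Q := by
  refine tendsto_of_tendsto_of_tendsto_of_le_of_le' h tendsto_const_nhds ?_
    (Eventually.of_forall fun n => gnmProb_le_one _ _ _)
  filter_upwards [hPQ] with n hn
  exact gnmProb_mono (fun F hF => hn _ hF)

open scoped Classical in
lemma degree_of_mem_Gam {r n : ℕ} (hr : 0 < r) {G : SimpleGraph (Fin n)}
    (hG : G ∈ Gam (((r : ℝ) + 1) / (2 * r)) n) (v : Fin n) :
    (r + 1) * n ≤ 2 * r * G.degree v := by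
  have h1 : ((r : ℝ) + 1) / (2 * r) * n ≤ G.minDegree := hG
  have h2 : (G.minDegree : ℝ) ≤ G.degree v := by exact_mod_cast G.minDegree_le_degree v
  have hr' : (0 : ℝ) < 2 * r := by positivity
  have h3 := h1.trans h2
  rw [div_mul_eq_mul_div, div_le_iff₀ hr'] at h3
  have h4 : ((r : ℝ) + 1) * n ≤ 2 * r * G.degree v := by linarith
  exact_mod_cast h4

/-- For all but few graphs `F` with `m` edges, all colourings of `G ∪ F` have a Hamilton cycle of
bias `k / r`. -/
lemma ncard_withEdges_diff_le {r n m k : ℕ} (hr : 2 ≤ r) {G : SimpleGraph (Fin n)}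
    (hG : G ∈ Gam (((r : ℝ) + 1) / (2 * r)) n) (hk : 720 * r * (k + 1) ≤ n) (hkm : 6 * k ≤ m)
    (hm : m ≤ n.choose 2) :
    ((withEdges n m \ {F | ∀ χ : Colouring r (G ⊔ F), ∃ (v : Fin n) (p : (G ⊔ F).Walk v v),
      p.IsHamiltonianCycle ∧ (k : ℝ) / r ≤ bias χ p}).ncard : ℝ) ≤
      (n.choose 2).choose m * (5 * ((6 * k + 1) * 103 ^ (6 * k) * (197 / 200) ^ m)) := by
  classical
  have hrk : k + 1 ≤ r * (k + 1) := Nat.le_mul_of_pos_left _ (by omega)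
  have hk' : 720 * (k + 1) ≤ 720 * (r * (k + 1)) := Nat.mul_le_mul_left _ hrk
  have hk'' : 720 * (r * (k + 1)) ≤ n := by linarith
  have hr0 : 0 < r := by omega
  have hGdeg := degree_of_mem_Gam hr0 hG
  obtain ⟨𝓘, h𝓘card, h𝓘large, h𝓘⟩ := exists_representative_indep (k := k) hr (G := G)
    (by simpa using hGdeg) (by rw [Fintype.card_fin]; omega) (by rw [Fintype.card_fin]; omega)
  rw [Fintype.card_fin] at h𝓘 h𝓘large
  set 𝓑 : Finset (Fin n) → Finset (Finset (Sym2 (Fin n))) := fun I =>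
    ((⊤ : SimpleGraph (Fin n)).edgeFinset.powersetCard m).filter
      (fun E => ∃ R : Finset (Fin n), R.card ≤ 6 * k ∧
        ∀ e ∈ E, (∀ v ∈ e, v ∈ I) → ∃ v ∈ e, v ∈ R) with h𝓑
  have hcount : ∀ I ∈ 𝓘, ((𝓑 I).card : ℝ) ≤
      (n.choose 2).choose m * ((6 * k + 1) * 103 ^ (6 * k) * (197 / 200) ^ m) := by
    intro I hI
    have := card_coverable_le (V := Fin n) hkm (by simpa using hm)
      (by rw [Fintype.card_fin]; omega) (by rw [Fintype.card_fin]; omega) I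
      (by rw [Fintype.card_fin]; exact h𝓘large I hI) (𝓑 I) (by
        intro E hE
        obtain ⟨hE1, hE2⟩ := Finset.mem_filter.1 hE
        obtain ⟨hE3, hE4⟩ := Finset.mem_powersetCard.1 hE1
        exact ⟨hE3, hE4, hE2⟩)
    rwa [Fintype.card_fin] at this
  have hsub : (fun F : SimpleGraph (Fin n) => F.edgeFinset) '' (withEdges n m \
      {F | ∀ χ : Colouring r (G ⊔ F), ∃ (v : Fin n) (p : (G ⊔ F).Walk v v),
        p.IsHamiltonianCycle ∧ (k : ℝ) / r ≤ bias χ p}) ⊆ ((𝓘.biUnion 𝓑 : Finset _) : Set _) := by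
    rintro _ ⟨F, ⟨hF, hbad⟩, rfl⟩
    simp only [Set.mem_ofPred_eq, not_forall] at hbad
    obtain ⟨χ, hχ⟩ := hbad
    rcases exists_biased_or_indep hr0 (U := G ⊔ F) (k := k) (by
        intro v
        rw [Fintype.card_fin]
        refine (hGdeg v).trans (Nat.mul_le_mul_left _ ?_)
        exact SimpleGraph.degree_le_of_le le_sup_left)
      (by rw [Fintype.card_fin]; linarith) χ with h | ⟨A, hA, hAcard⟩
    · exact absurd h hχ
    · rw [Fintype.card_fin] at hAcard
      obtain ⟨I, hI, hIA⟩ := h𝓘 A (fun u hu v hv h => hA u hu v hv (Or.inl h)) hAcard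
      have hFmem : F.edgeFinset ∈ (⊤ : SimpleGraph (Fin n)).edgeFinset.powersetCard m := by
        rw [← Finset.mem_coe, ← image_edgeFinset_withEdges]
        exact ⟨F, hF, by congr!⟩
      simp only [Finset.coe_biUnion, Set.mem_iUnion, Finset.mem_coe]
      refine ⟨I, hI, Finset.mem_filter.2 ⟨hFmem, I \ A, hIA, fun e he heI => ?_⟩⟩
      rw [SimpleGraph.mem_edgeFinset] at he
      induction e with
      | _ u v =>
        by_contra! hcon
        have hmemA : ∀ w ∈ s(u, v), w ∈ A := by
          intro w hw
          by_contra hwA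
          exact hcon w hw (Finset.mem_sdiff.2 ⟨heI w hw, hwA⟩)
        exact hA u (hmemA u (by simp)) v (hmemA v (by simp)) (Or.inr he)
  have h1 := Set.ncard_le_ncard hsub (Finset.finite_toSet _)
  rw [Set.ncard_image_of_injective _ (edgeFinset_injective n), Set.ncard_coe_finset] at h1
  have h2 : ((𝓘.biUnion 𝓑).card : ℝ) ≤ ∑ I ∈ 𝓘, ((𝓑 I).card : ℝ) := by
    exact_mod_cast Finset.card_biUnion_le
  have h3 := Finset.sum_le_card_nsmul 𝓘 _ _ hcount
  rw [nsmul_eq_mul] at h3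
  have h4 : (𝓘.card : ℝ) ≤ 5 := by exact_mod_cast h𝓘card
  have h5 := mul_le_mul_of_nonneg_right h4
    (show (0 : ℝ) ≤ (n.choose 2).choose m * ((6 * k + 1) * 103 ^ (6 * k) * (197 / 200) ^ m) by
      positivity)
  have h6 : ((withEdges n m \ {F | ∀ χ : Colouring r (G ⊔ F), ∃ (v : Fin n)
      (p : (G ⊔ F).Walk v v), p.IsHamiltonianCycle ∧ (k : ℝ) / r ≤ bias χ p}).ncard : ℝ) ≤
      (𝓘.biUnion 𝓑).card := by exact_mod_cast h1
  calc _ ≤ _ := h6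
    _ ≤ _ := h2
    _ ≤ _ := h3
    _ ≤ _ := h5
    _ = _ := by ring

/-- If `k` is small compared to `m`, then the failure probability decays exponentially in `m`. -/
lemma exists_failure_bound : ∃ C : ℝ, 0 ≤ C ∧ ∀ m k : ℕ, 4200 * k ≤ m + 4200 →
    5 * ((6 * (k : ℝ) + 1) * 103 ^ (6 * k) * (197 / 200) ^ m) ≤
      C * ((6 * m + 7) * (199 / 200) ^ m) := by
  obtain ⟨N, hN⟩ : ∃ N, N = 4200 := ⟨_, rfl⟩
  have h1 : (103 : ℝ) ^ 6 ≤ (101 / 100) ^ N := by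
    have h2 : (2 : ℝ) ≤ (101 / 100) ^ 100 := by
      have := one_add_mul_le_pow (a := (1 / 100 : ℝ)) (by norm_num) 100
      norm_num at this ⊢
    calc (103 : ℝ) ^ 6 ≤ 2 ^ 42 := by norm_num
      _ ≤ ((101 / 100) ^ 100) ^ 42 := by gcongr
      _ = (101 / 100) ^ N := by rw [← pow_mul, hN]
  refine ⟨5 * (101 / 100) ^ N, by positivity, fun m k hk => ?_⟩
  have h3 : (103 : ℝ) ^ (6 * k) ≤ (101 / 100) ^ N * (101 / 100) ^ m := by
    calc (103 : ℝ) ^ (6 * k) = (103 ^ 6) ^ k := pow_mul _ _ _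
      _ ≤ ((101 / 100) ^ N) ^ k := by gcongr
      _ = (101 / 100) ^ (N * k) := (pow_mul _ _ _).symm
      _ ≤ (101 / 100) ^ (m + N) := pow_le_pow_right₀ (by norm_num) (hN ▸ hk)
      _ = _ := by rw [pow_add, mul_comm]
  have h4 : (k : ℝ) ≤ m + 1 := by
    have : k ≤ m + 1 := by omega
    exact_mod_cast this
  calc 5 * ((6 * (k : ℝ) + 1) * 103 ^ (6 * k) * (197 / 200) ^ m)
      ≤ 5 * ((6 * (m + 1 : ℝ) + 1) * ((101 / 100) ^ N * (101 / 100) ^ m) *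
          (197 / 200) ^ m) := by gcongr
    _ = (5 * (101 / 100) ^ N) * ((6 * m + 7) * (101 / 100 * (197 / 200)) ^ m) := by
        rw [mul_pow]; ring
    _ ≤ _ := by gcongr; norm_num

/-- With high probability, all colourings of `G n ∪ G(n, m n)` have a Hamilton cycle of bias
`k n / r`, if `k n` is at most about `m n / 2 ^ 20` and at most a small multiple of `n / r`. -/
theorem unionWhp_exists_biased {r : ℕ} (hr : 2 ≤ r) {m k : ℕ → ℕ} (hm : Tendsto m atTop atTop)
    (hmn : ∀ᶠ n in atTop, m n ≤ n) (hkm : ∀ᶠ n in atTop, 2 ^ 20 * k n ≤ m n + 2 ^ 20)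
    (hkn : ∀ᶠ n in atTop, 720 * r * (k n + 1) ≤ n) {G : ∀ n, SimpleGraph (Fin n)}
    (hG : ∀ᶠ n in atTop, G n ∈ Gam (((r : ℝ) + 1) / (2 * r)) n) :
    UnionWhp G m (fun n U => ∀ χ : Colouring r U, ∃ (v : Fin n) (p : U.Walk v v),
      p.IsHamiltonianCycle ∧ (k n : ℝ) / r ≤ bias χ p) := by
  obtain ⟨C, hC0, hC⟩ := exists_failure_bound
  have hlim : Tendsto (fun n => 1 - C * ((6 * (m n : ℝ) + 7) * (199 / 200) ^ m n)) atTop (𝓝 1) := by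
    have h1 : Tendsto (fun j : ℕ => (j : ℝ) * (199 / 200 : ℝ) ^ j) atTop (𝓝 0) :=
      tendsto_self_mul_const_pow_of_lt_one (by norm_num) (by norm_num)
    have h2 : Tendsto (fun j : ℕ => (199 / 200 : ℝ) ^ j) atTop (𝓝 0) :=
      tendsto_pow_atTop_nhds_zero_of_lt_one (by norm_num) (by norm_num)
    have h3 : Tendsto (fun j : ℕ => 1 - C * ((6 * (j : ℝ) + 7) * (199 / 200) ^ j)) atTop (𝓝 1) := by
      have h4 := (((h1.const_mul 6).add (h2.const_mul 7)).const_mul C).const_sub 1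
      have h0 : (1 : ℝ) - C * (6 * 0 + 7 * 0) = 1 := by
        rw [mul_zero, mul_zero, add_zero, mul_zero, sub_zero]
      rw [h0] at h4
      refine h4.congr (fun j => ?_)
      ring
    exact h3.comp hm
  refine tendsto_of_tendsto_of_tendsto_of_le_of_le' hlim tendsto_const_nhds ?_
    (Eventually.of_forall fun n => gnmProb_le_one _ _ _)
  filter_upwards [hmn, hkm, hkn, hG, hm.eventually_ge_atTop 7, eventually_ge_atTop 3]
    with n h1 h2 h3 h4 h5 h6
  have hmc : m n ≤ n.choose 2 := by
    refine h1.trans ?_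
    rw [Nat.choose_two_right, Nat.le_div_iff_mul_le (by norm_num)]
    exact Nat.mul_le_mul_left n (by omega)
  refine one_sub_le_gnmProb hmc ((ncard_withEdges_diff_le hr h4 h3 (by omega) hmc).trans ?_)
  exact mul_le_mul_of_nonneg_left (hC _ _ (by omega)) (by positivity)

end ColourBias

/-! ### The extremal construction -/

namespace ColourBias

section UpperBound

lemma sum_edgeSum_edges {V : Type*} {U : SimpleGraph V} (f : V → ℕ) :
    ∀ {u v : V} (p : U.Walk u v),
      (p.edges.map (edgeSum f)).sum + f u + f v = 2 * (p.support.map f).sum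
  | _, _, .nil => by simp; ring
  | u, w, .cons (v := v) h p => by
      have := sum_edgeSum_edges f p
      simp only [SimpleGraph.Walk.edges_cons, List.map_cons, List.sum_cons, edgeSum_mk,
        SimpleGraph.Walk.support_cons]
      omega

/-- Every vertex lies on exactly two edges of a Hamilton cycle. -/
lemma sum_edgeSum_of_isHamiltonianCycle {V : Type*} [Fintype V] [DecidableEq V]
    {U : SimpleGraph V} (f : V → ℕ) {v : V} {p : U.Walk v v} (hp : p.IsHamiltonianCycle) :
    (p.edges.map (edgeSum f)).sum = 2 * ∑ u, f u := by
  have h1 := sum_edgeSum_edges f p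
  have h2 := (SimpleGraph.Walk.isHamiltonianCycle_iff_isCycle_and_support_count_tail_eq_one.1 hp).2
  have hnd : p.support.tail.Nodup := List.nodup_iff_count_le_one.2 fun u => (h2 u).le
  have h3 : p.support.tail.toFinset = Finset.univ := by
    ext u
    simp only [List.mem_toFinset, Finset.mem_univ, iff_true]
    exact List.count_pos_iff.1 (by rw [h2 u]; exact one_pos)
  have h4 : ∑ u, f u = (p.support.tail.map f).sum := by
    rw [← h3, List.sum_toFinset f hnd]
  have h5 : (p.support.map f).sum = f v + (p.support.tail.map f).sum := by
    rw [← List.sum_cons, ← List.map_cons, SimpleGraph.Walk.cons_tail_support]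
  omega

/-- The complete graph on `n` vertices without the edges between the first `a` vertices. -/
def splitGraph (n a : ℕ) : SimpleGraph (Fin n) where
  Adj u v := u ≠ v ∧ ¬ ((u : ℕ) < a ∧ (v : ℕ) < a)
  symm := ⟨fun _ _ h => ⟨h.1.symm, fun h' => h.2 ⟨h'.2, h'.1⟩⟩⟩
  loopless := ⟨fun _ h => h.1 rfl⟩

lemma splitGraph_mem_Gam {α : ℝ} {n a : ℕ} (ha : 0 < a) (han : a ≤ n) (hα : α * n ≤ n - a) :
    splitGraph n a ∈ Gam α n := by
  classical
  have : Nonempty (Fin n) := ⟨⟨0, by omega⟩⟩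
  have hcard : (Finset.univ.filter (fun v : Fin n => (v : ℕ) < a)).card = a := by
    rw [Fin.card_filter_val_lt, Nat.min_eq_right han]
  have h : n - a ≤ (splitGraph n a).minDegree := by
    refine SimpleGraph.le_minDegree_of_forall_le_degree _ _ (fun v => ?_)
    rw [← SimpleGraph.card_neighborFinset_eq_degree]
    by_cases hv : (v : ℕ) < a
    · have h1 : (Finset.univ.filter (fun v : Fin n => (v : ℕ) < a))ᶜ ⊆
          (splitGraph n a).neighborFinset v := by
        intro w hw
        simp only [Finset.mem_compl, Finset.mem_filter, Finset.mem_univ, true_and] at hw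
        rw [SimpleGraph.mem_neighborFinset]
        exact ⟨fun h => hw (h ▸ hv), fun h => hw h.2⟩
      refine le_trans ?_ (Finset.card_le_card h1)
      rw [Finset.card_compl, hcard, Fintype.card_fin]
    · have h1 : Finset.univ.erase v ⊆ (splitGraph n a).neighborFinset v := by
        intro w hw
        rw [SimpleGraph.mem_neighborFinset]
        exact ⟨(Finset.ne_of_mem_erase hw).symm, fun h => hv h.1⟩
      refine le_trans ?_ (Finset.card_le_card h1)
      rw [Finset.card_erase_of_mem (Finset.mem_univ v), Finset.card_univ, Fintype.card_fin]
      omega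
  have h' : ((n : ℝ) - a) ≤ ((splitGraph n a).minDegree : ℝ) := by
    rw [← Nat.cast_sub han]
    exact_mod_cast h
  exact hα.trans h'

/-- The extremal colouring of the pairs of vertices: a pair with exactly one vertex `u` among the
first `a` vertices receives the residue of `u` modulo `r - 1`, and all other pairs receive the
last of the `r` colours. -/
def extremalColour {r : ℕ} (hr : 2 ≤ r) (n a : ℕ) : Sym2 (Fin n) → Fin r :=
  Sym2.lift ⟨fun u v =>
    if (u : ℕ) < a ∧ ¬ (v : ℕ) < a then
      ⟨u % (r - 1), (Nat.mod_lt _ (by omega)).trans (by omega)⟩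
    else if (v : ℕ) < a ∧ ¬ (u : ℕ) < a then
      ⟨v % (r - 1), (Nat.mod_lt _ (by omega)).trans (by omega)⟩
    else ⟨r - 1, by omega⟩, by
      intro u v
      by_cases hu : (u : ℕ) < a <;> by_cases hv : (v : ℕ) < a <;> simp [hu, hv]⟩

lemma extremalColour_mk {r : ℕ} (hr : 2 ≤ r) (n a : ℕ) (u v : Fin n) :
    (extremalColour hr n a s(u, v) : ℕ) = if (u : ℕ) < a ∧ ¬ (v : ℕ) < a then u % (r - 1)
      else if (v : ℕ) < a ∧ ¬ (u : ℕ) < a then v % (r - 1) else r - 1 := by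
  simp only [extremalColour, Sym2.lift_mk]
  split_ifs <;> rfl

lemma countP_extremalColour_le_of_ne_last {r : ℕ} (hr : 2 ≤ r) {n a q : ℕ}
    (hq : a ≤ (r - 1) * q) {U : SimpleGraph (Fin n)} {v : Fin n} {p : U.Walk v v}
    (hp : p.IsHamiltonianCycle) {i : Fin r} (hi : (i : ℕ) ≠ r - 1) :
    (p.edges : Multiset (Sym2 (Fin n))).countP (extremalColour hr n a · = i) ≤ 2 * q := by
  set f : Fin n → ℕ := fun u => if (u : ℕ) < a ∧ (u : ℕ) % (r - 1) = i then 1 else 0 with hf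
  have h1 : ∑ u, f u ≤ q := by
    simp only [hf]
    rw [← Finset.card_filter]
    refine (Finset.card_le_card_of_injOn (t := Finset.range q) (fun u : Fin n => (u : ℕ) / (r - 1))
      ?_ ?_).trans (Finset.card_range q).le
    · intro u hu
      have hu' := (Finset.mem_filter.1 (Finset.mem_coe.1 hu)).2
      rw [Finset.mem_coe, Finset.mem_range]
      exact Nat.div_lt_of_lt_mul (hu'.1.trans_le hq)
    · intro u hu w hw huw
      have hu' := (Finset.mem_filter.1 (Finset.mem_coe.1 hu)).2
      have hw' := (Finset.mem_filter.1 (Finset.mem_coe.1 hw)).2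
      simp only at huw
      apply Fin.ext
      rw [← Nat.div_add_mod (u : ℕ) (r - 1), ← Nat.div_add_mod (w : ℕ) (r - 1), huw, hu'.2, hw'.2]
  refine (countP_le_sum_map _ (edgeSum f) (fun e he => ?_) _).trans ?_
  · induction e with
    | _ u w =>
      rw [Fin.ext_iff, extremalColour_mk] at he
      simp only [edgeSum_mk, hf]
      split_ifs at he with h2 h3
      · rw [if_pos ⟨h2.1, he⟩]; omega
      · rw [if_pos (⟨h3.1, he⟩ : (w : ℕ) < a ∧ (w : ℕ) % (r - 1) = i)]; omega
      · exact absurd he.symm hi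
  · rw [Multiset.map_coe, Multiset.sum_coe, sum_edgeSum_of_isHamiltonianCycle f hp]
    omega

lemma countP_extremalColour_last_le {r : ℕ} (hr : 2 ≤ r) {n a m : ℕ} (han : a ≤ n)
    {F : SimpleGraph (Fin n)} (hF : F ∈ withEdges n m) {v : Fin n}
    {p : (splitGraph n a ⊔ F).Walk v v} (hp : p.IsHamiltonianCycle) {i : Fin r}
    (hi : (i : ℕ) = r - 1) :
    (p.edges : Multiset (Sym2 (Fin n))).countP (extremalColour hr n a · = i) + 2 * a ≤
      n + 2 * m := by
  classical
  set f : Fin n → ℕ := fun u => if (u : ℕ) < a then 1 else 0 with hf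
  have hfa : ∑ u, f u = a := by
    rw [hf, ← Finset.card_filter, Fin.card_filter_val_lt, Nat.min_eq_right han]
  have h1 := sum_edgeSum_of_isHamiltonianCycle f hp
  rw [hfa] at h1
  have hAA : (p.edges : Multiset (Sym2 (Fin n))).countP
      (fun e => ∀ u : Fin n, u ∈ e → (u : ℕ) < a) ≤ m := by
    have hsub : (p.edges.toFinset.filter (fun e => ∀ u : Fin n, u ∈ e → (u : ℕ) < a)) ⊆
        F.edgeFinset := by
      intro e he
      obtain ⟨he, hea⟩ := Finset.mem_filter.1 he
      have hU := p.edges_subset_edgeSet (List.mem_toFinset.1 he)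
      rw [SimpleGraph.mem_edgeFinset]
      induction e with
      | _ u w =>
        rcases hU with h | h
        · exact absurd ⟨hea u (by simp), hea w (by simp)⟩ h.2
        · exact h
    have hFm : F.edgeFinset.card = m := by
      rw [← hF, ← SimpleGraph.coe_edgeFinset, Set.ncard_coe_finset]
    rw [← hFm]
    refine le_trans (le_of_eq ?_) (Finset.card_le_card hsub)
    rw [Finset.card_def, Finset.filter_val, List.toFinset_val,
      hp.isCycle.isTrail.edges_nodup.dedup, Multiset.countP_eq_card_filter]
  have key : ∀ l : List (Sym2 (Fin n)),
      (l : Multiset (Sym2 (Fin n))).countP (extremalColour hr n a · = i) +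
        (l.map (edgeSum f)).sum ≤
      l.length + 2 * (l : Multiset (Sym2 (Fin n))).countP
        (fun e => ∀ u : Fin n, u ∈ e → (u : ℕ) < a) := by
    intro l
    induction l with
    | nil => simp
    | cons e l ih =>
      rw [← Multiset.cons_coe, Multiset.countP_cons, Multiset.countP_cons, List.map_cons,
        List.sum_cons, List.length_cons]
      suffices h : (if extremalColour hr n a e = i then 1 else 0) + edgeSum f e ≤
          1 + 2 * (if ∀ u : Fin n, u ∈ e → (u : ℕ) < a then 1 else 0) by omega
      induction e with
      | _ u w =>
        have hlt : ∀ u : Fin n, (u : ℕ) % (r - 1) ≠ r - 1 := fun u =>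
          (Nat.mod_lt _ (by omega)).ne
        simp only [Fin.ext_iff (b := i), extremalColour_mk, hi, edgeSum_mk, hf, Sym2.mem_iff,
          forall_eq_or_imp, forall_eq]
        by_cases hu : (u : ℕ) < a <;> by_cases hw : (w : ℕ) < a <;> simp [hu, hw, hlt]
  have h2 := key p.edges
  have h3 : p.edges.length = n := by
    rw [SimpleGraph.Walk.length_edges, hp.length_eq, Fintype.card_fin]
  rw [h1, h3] at h2
  omega

/-- The extremal colouring bounds the colour bias: on a Hamilton cycle, the edges at the first `a`
vertices are distributed evenly among the first `r - 1` colours, up to the edges of `F`. -/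
lemma hr_splitGraph_le {r : ℕ} (hr2 : 2 ≤ r) {n a q m : ℕ} {B : ℝ} (han : a ≤ n)
    (hq : a ≤ (r - 1) * q) (hqB : (2 * q : ℝ) ≤ (n : ℝ) / r + B)
    (haB : (n : ℝ) + 2 * m - 2 * a ≤ (n : ℝ) / r + B)
    {F : SimpleGraph (Fin n)} (hF : F ∈ withEdges n m) :
    hr r (splitGraph n a ⊔ F) ≤ (B : EReal) := by
  have hr0 : 0 < r := by omega
  obtain ⟨χ, hχ⟩ : ∃ χ : Colouring r (splitGraph n a ⊔ F), ∀ e, χ e = extremalColour hr2 n a e :=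
    ⟨fun e => extremalColour hr2 n a e, fun _ => rfl⟩
  refine iInf_le_of_le χ ?_
  refine iSup_le fun v => iSup_le fun p => iSup_le fun hp => ?_
  rw [EReal.coe_le_coe_iff]
  have : Nonempty (Fin r) := ⟨⟨0, hr0⟩⟩
  refine ciSup_le fun i => ?_
  rw [colourCount_eq_countP hr0 _ hp.isCycle.isTrail.edges_nodup, Fintype.card_fin]
  have hcongr : (p.edges : Multiset (Sym2 (Fin n))).countP
      (extendColouring hr0 χ · = i) =
      (p.edges : Multiset (Sym2 (Fin n))).countP (extremalColour hr2 n a · = i) := by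
    refine Multiset.countP_congr rfl fun e he => ?_
    have he' := p.edges_subset_edgeSet (Multiset.mem_coe.1 he)
    simp only [extendColouring, he', dif_pos, hχ]
  rw [hcongr, sub_le_iff_le_add, add_comm B]
  by_cases hi : (i : ℕ) = r - 1
  · have h := countP_extremalColour_last_le hr2 han hF hp hi
    have h' : (((p.edges : Multiset (Sym2 (Fin n))).countP (extremalColour hr2 n a · = i) : ℕ) : ℝ)
      + 2 * a ≤ n + 2 * m := by exact_mod_cast h
    linarith
  · have h := countP_extremalColour_le_of_ne_last hr2 hq hp hi
    have h' : (((p.edges : Multiset (Sym2 (Fin n))).countP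
      (extremalColour hr2 n a · = i) : ℕ) : ℝ) ≤ 2 * q := by exact_mod_cast h
    linarith

end UpperBound

end ColourBias

/-! ### The two bounds -/

namespace ColourBias

/-- The lower bound, for all colourings instead of for `hr`. With `k = ⌊m / d⌋ + 1`
gadgets, the bias is at least `k / r`. -/
lemma unionWhp_bias_of_div {r d : ℕ} (hr : 2 ≤ r) (hd : 2 ^ 20 ≤ d) {m : ℕ → ℕ}
    (hm : Tendsto m atTop atTop) (hmn : ∀ᶠ n in atTop, m n ≤ n)
    (hmd : ∀ᶠ n in atTop, 2 ^ 20 * r * m n ≤ d * n) {G : ∀ n, SimpleGraph (Fin n)}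
    (hG : ∀ᶠ n in atTop, G n ∈ Gam (((r : ℝ) + 1) / (2 * r)) n) :
    UnionWhp G m (fun n U => ∀ χ : Colouring r U, ∃ (v : Fin n) (p : U.Walk v v),
      p.IsHamiltonianCycle ∧ (m n : ℝ) / (d * r) ≤ bias χ p) := by
  have hd0 : 0 < d := lt_of_lt_of_le (by norm_num) hd
  have hk : ∀ n, d * (m n / d) ≤ m n := fun n => Nat.mul_div_le _ _
  refine (unionWhp_exists_biased hr (k := fun n => m n / d + 1) hm hmn ?_ ?_ hG).mono ?_
  · refine Eventually.of_forall fun n => ?_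
    have := Nat.mul_le_mul_right (m n / d) hd
    have := hk n
    omega
  · filter_upwards [hmd, eventually_ge_atTop (2880 * r)] with n h1 h2
    have h3 : d * (2 ^ 20 * r * (m n / d)) ≤ d * n := by
      have := Nat.mul_le_mul_left (2 ^ 20 * r) (hk n)
      nlinarith
    have h4 := Nat.le_of_mul_le_mul_left h3 hd0
    nlinarith
  · refine Eventually.of_forall fun n U h χ => ?_
    obtain ⟨v, p, hp, hb⟩ := h χ
    refine ⟨v, p, hp, le_trans ?_ hb⟩
    have hd' : (0 : ℝ) < d := by exact_mod_cast hd0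
    have hr' : (0 : ℝ) < r := by positivity
    rw [← div_div]
    gcongr
    rw [div_le_iff₀ hd']
    have := (Nat.lt_mul_div_succ (m n) hd0).le
    have h5 : (m n : ℝ) ≤ d * ((m n / d + 1 : ℕ) : ℝ) := by exact_mod_cast this
    linarith

lemma le_hr_of_forall {V : Type*} [Fintype V] [DecidableEq V] {r : ℕ} {U : SimpleGraph V} {t : ℝ}
    (h : ∀ χ : Colouring r U, ∃ (v : V) (p : U.Walk v v), p.IsHamiltonianCycle ∧ t ≤ bias χ p) :
    (t : EReal) ≤ hr r U := by
  refine le_iInf fun χ => ?_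
  obtain ⟨v, p, hp, hb⟩ := h χ
  exact le_iSup_of_le v (le_iSup_of_le p (le_iSup_of_le hp (EReal.coe_le_coe_iff.2 hb)))

end ColourBias

theorem theorem1p6 (r : ℕ) (hr2 : 2 ≤ r) (α : ℝ) (hα : α = ((r : ℝ) + 1) / (2 * r)) :
    -- linear lower bound for `1 ≪ m ≤ n`, with a constant that depends on `r` only
    (∃ c : ℝ, 0 < c ∧ ∀ m : ℕ → ℕ, Filter.Tendsto m Filter.atTop Filter.atTop →
      (∀ᶠ n in Filter.atTop, m n ≤ n) →
      ∀ G : ∀ n, SimpleGraph (Fin n), (∀ᶠ n in Filter.atTop, G n ∈ ColourBias.Gam α n) →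
        ColourBias.UnionWhp G m
          (fun n U => ((c * (m n : ℝ) : ℝ) : EReal) ≤ ColourBias.hr r U)) ∧
    -- explicit lower bound for `1 ≪ m < 2⁻⁵ r⁻¹ n`
    (∀ m : ℕ → ℕ, Filter.Tendsto m Filter.atTop Filter.atTop →
      (∀ᶠ n in Filter.atTop, (m n : ℝ) < (n : ℝ) / (2 ^ 5 * r)) →
      ∀ G : ∀ n, SimpleGraph (Fin n), (∀ᶠ n in Filter.atTop, G n ∈ ColourBias.Gam α n) →
        ColourBias.UnionWhp G m
          (fun n U => ∀ χ : ColourBias.Colouring r U, ∃ (v : Fin n) (p : U.Walk v v),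
            p.IsHamiltonianCycle ∧ (m n : ℝ) / (2 ^ 20 * r) ≤ ColourBias.bias χ p)) ∧
    -- explicit deterministic upper bound when `2 r` divides `n`, for every `m ≥ 0`
    (∀ n : ℕ, 0 < n → 2 * r ∣ n → ∀ m : ℕ, ∃ G ∈ ColourBias.Gam α n,
      ∀ F ∈ ColourBias.withEdges n m,
        ColourBias.hr r (G ⊔ F) ≤ ((2 * ((r : ℝ) - 1) * m : ℝ) : EReal)) ∧
    -- deterministic upper bound `O(m)` without divisibility
    (∃ C : ℝ, 0 < C ∧ ∀ n : ℕ, 4 ≤ n → ∀ m : ℕ, 1 ≤ m → ∃ G ∈ ColourBias.Gam α n,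
      ∀ F ∈ ColourBias.withEdges n m,
        ColourBias.hr r (G ⊔ F) ≤ ((C * (m : ℝ) : ℝ) : EReal)) := by
  subst hα
  have hr0 : 0 < r := by omega
  have hr' : (0 : ℝ) < r := by exact_mod_cast hr0
  refine ⟨?_, ?_, ?_, ?_⟩
  · refine ⟨1 / (2 ^ 20 * r * r), by positivity, fun m hm hmn G hG => ?_⟩
    refine (ColourBias.unionWhp_bias_of_div (d := 2 ^ 20 * r) hr2
      (Nat.le_mul_of_pos_right _ hr0) hm hmn ?_ hG).mono ?_
    · filter_upwards [hmn] with n hn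
      exact Nat.mul_le_mul_left _ hn
    · refine Eventually.of_forall fun n U h => ColourBias.le_hr_of_forall ?_
      have heq : (1 : ℝ) / (2 ^ 20 * r * r) * m n = m n / ((2 ^ 20 * r : ℕ) * r) := by
        rw [one_div_mul_eq_div, Nat.cast_mul, Nat.cast_pow, Nat.cast_ofNat]
      rwa [heq]
  · intro m hm hmn G hG
    have hmn' : ∀ᶠ n in atTop, r * m n ≤ n := by
      filter_upwards [hmn] with n hn
      rw [lt_div_iff₀ (by positivity)] at hn
      have h1 : (r : ℝ) * m n ≤ n := by
        have : (0 : ℝ) ≤ r * m n := by positivity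
        nlinarith
      exact_mod_cast h1
    have h := ColourBias.unionWhp_bias_of_div (d := 2 ^ 20) hr2 le_rfl hm
      (hmn'.mono fun n hn => (Nat.le_mul_of_pos_left _ hr0).trans hn)
      (hmn'.mono fun n hn => by rw [mul_assoc]; exact Nat.mul_le_mul_left _ hn) hG
    exact_mod_cast h
  · rintro n hn ⟨t, rfl⟩ m
    obtain ⟨s, rfl⟩ : ∃ s, r = s + 1 := ⟨r - 1, by omega⟩
    have hs : 1 ≤ s := by omega
    have ht : 0 < t := Nat.pos_of_mul_pos_left hn
    have hs' : (1 : ℝ) ≤ s := by exact_mod_cast hs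
    have hdiv : ((2 * (s + 1) * t : ℕ) : ℝ) / ((s + 1 : ℕ) : ℝ) = 2 * t := by
      push_cast
      field_simp
    have han : s * t ≤ 2 * (s + 1) * t := by nlinarith
    refine ⟨ColourBias.splitGraph (2 * (s + 1) * t) (s * t),
      ColourBias.splitGraph_mem_Gam (by positivity) han ?_, fun F hF => ?_⟩
    · push_cast
      rw [div_mul_eq_mul_div, div_le_iff₀ (by positivity)]
      nlinarith
    · have hm : (0 : ℝ) ≤ m := by positivity
      have hms : (m : ℝ) ≤ s * m := by nlinarith
      refine ColourBias.hr_splitGraph_le hr2 (q := t) han le_rfl ?_ ?_ hF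
      · rw [hdiv]
        push_cast
        nlinarith
      · rw [hdiv]
        push_cast
        nlinarith
  · refine ⟨4, by norm_num, fun n hn m hm => ?_⟩
    obtain ⟨s, rfl⟩ : ∃ s, r = s + 1 := ⟨r - 1, by omega⟩
    have hs : 1 ≤ s := by omega
    -- The independent set has the largest size that the minimum degree allows.
    set a := s * n / (2 * (s + 1)) with ha
    have ha1 : 2 * (s + 1) * a ≤ s * n := Nat.mul_div_le _ _
    have ha2 : s * n < 2 * (s + 1) * (a + 1) := Nat.lt_mul_div_succ _ (by omega)
    have ha0 : 0 < a := Nat.div_pos (by nlinarith) (by omega)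
    have han : a ≤ n := by nlinarith
    have hq := (Nat.lt_mul_div_succ a (show 0 < s by omega)).le
    have ha1' : 2 * ((s : ℝ) + 1) * a ≤ s * n := by exact_mod_cast ha1
    have ha2' : (s : ℝ) * n ≤ 2 * (s + 1) * (a + 1) := by exact_mod_cast ha2.le
    have hs' : (1 : ℝ) ≤ s := by exact_mod_cast hs
    have hm' : (1 : ℝ) ≤ m := by exact_mod_cast hm
    refine ⟨ColourBias.splitGraph n a, ColourBias.splitGraph_mem_Gam ha0 han ?_, fun F hF => ?_⟩
    · push_cast
      rw [div_mul_eq_mul_div, div_le_iff₀ (by positivity)]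
      nlinarith
    · refine ColourBias.hr_splitGraph_le hr2 (q := a / s + 1) han hq ?_ ?_ hF
      · have h1 : s * (a / s) ≤ a := Nat.mul_div_le _ _
        have h2 : 2 * (s + 1) * (s * (a / s)) ≤ s * n := (Nat.mul_le_mul_left _ h1).trans ha1
        have h3 : 2 * (s + 1) * (a / s) ≤ n :=
          Nat.le_of_mul_le_mul_left (by nlinarith) hs
        have h4 : 2 * ((s : ℝ) + 1) * ((a / s : ℕ) : ℝ) ≤ n := by exact_mod_cast h3
        have h5 : 2 * ((a / s : ℕ) : ℝ) ≤ (n : ℝ) / ((s : ℝ) + 1) := by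
          rw [le_div_iff₀ (by positivity)]
          linarith
        rw [Nat.cast_add, Nat.cast_one, Nat.cast_add, Nat.cast_one]
        linarith
      · have h5 : (n : ℝ) - 2 * a - 2 ≤ (n : ℝ) / ((s : ℝ) + 1) := by
          rw [le_div_iff₀ (by positivity)]
          nlinarith
        rw [Nat.cast_add, Nat.cast_one]
        linarith
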